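/- Consider $\min_{x\in\mathbb{R}^d} F(x):=f(x)+h(x)$ with $f=\frac1n\sum_{i=1}^n f_i$, $f_i:\mathbb{R}^d\to\mathbb{R}$, and $h:\mathbb{R}^d\to\mathbb{R}\cup\{+\infty\}$ proper, convex and lower semicontinuous. For $\emptyset\ne S\subseteq[n]$ put $f_S=\frac1{|S|}\sum_{i\in S}f_i$. Assume that each $f_i$ is twice continuously differentiable and that there are $\mu,L>0$ with $\mu I\preceq\nabla^2 f_S(x)\preceq LI$ for all $x\in\mathbb{R}^d$ and all nonempty $S\subseteq[n]$. Let $x^*$ be the minimizer of $F$ and $F^*=F(x^*)$. Write $\|v\|_B^2=v^\top Bv$. Algorithm. Fix $x_0=w_0\in\mathbb{R}^d$, a step size $\eta>0$, a probability $p\in(0,1)$, an update frequency $r\ge1$ and a memory size $l$. For $k=0,1,2,\dots$: (a) If $k=tr$ with $t\ge1$, set $\bar x^t=\frac1r\sum_{j=k-r+1}^{k}x_j$ (with $\bar x^0=0$), sample a nonempty $\mathcal S^t\subseteq[n]$, and compute $s^t=\bar x^t-\bar x^{t-1}$ and $y^t=\nabla^2 f_{\mathcal S^t}(\bar x^t)s^t$.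 The pair $(s^t,y^t)$ is stored if $(s^t)^\top y^t>0$ (equivalently $s^t\neq0$), and only the $l$ latest stored pairs are kept. (b) Let $B_k=I$ if $k<r$. If $k\ge r$, let $B_k=B^t$, $t=\lfloor k/r\rfloor$, be the L-BFGS matrix of the pairs $(s_1,y_1),\dots,(s_m,y_m)$ in memory after the $t$-th update (from the oldest to the latest), $$B^t=\sigma_0I-\begin{bmatrix}\sigma_0S&Y\end{bmatrix}\begin{bmatrix}\sigma_0S^\top S&\Lambda\\ \Lambda^\top&-D\end{bmatrix}^{-1}\begin{bmatrix}\sigma_0S^\top\\Y^\top\end{bmatrix},\qquad \sigma_0=\frac{y_m^\top y_m}{y_m^\top s_m},$$ where $S=[s_1,\dots,s_m]$, $Y=[y_1,\dots,y_m]$, $D=\mathrm{diag}(s_1^\top y_1,\dots,s_m^\top y_m)$, and $\Lambda_{ij}=s_i^\top y_j$ if $i>j$ and $\Lambda_{ij}=0$ otherwise ($B^t=I$ if no pair is stored). (c) Sample $i_k$ uniformly from $[n]$ and set $v_k=\nabla f_{i_k}(x_k)-\nabla f_{i_k}(w_k)+\nabla f(w_k)$. (d) Set $x_{k+1}=\arg\min_{x}\{v_k^\top(x-x_k)+\frac1{2\eta}\|x-x_k\|_{B_k}^2+h(x)\}$.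 (e) Set $w_{k+1}=x_k$ with probability $p$ and $w_{k+1}=w_k$ with probability $1-p$. All random choices (the indices $i_k$, the choices in (e), and the sets $\mathcal S^t$, whose laws are arbitrary) are mutually independent. Theorem. Let $m_1,m_2>0$ be constants such that, almost surely, $m_1I\preceq B_k\preceq m_2I$ for all $k\ge0$ (since $B_k=I$ for $k<r$, this includes $m_1\le1\le m_2$ when $d\ge 1$). Let $A>\frac{8m_2L}{m_1^2p}$, let $$0<\eta\le\min\left\{\frac{m_1}{L},\ \frac{2m_1^2m_2}{8m_2^2L+2m_1^2\mu+Apm_1^2m_2}\right\},\qquad \rho:=\max\left\{1-\frac{\eta\mu}{m_2},\ \frac{8m_2L}{m_1^2A}+1-p\right\},$$ and let $r$ be such that $\left(\frac{m_2}{m_1}\right)^{1/r}\rho<1$. Define $\phi_k=\|x_k-x^*\|_{B_k}^2+A\eta^2\,(F(w_k)-F^*)+2\eta\,(F(x_k)-F^*)\in[0,+\infty]$. Then $\rho\in(0,1)$, and for every $k\ge r$ the function $\phi_k$ is (almost everywhere) measurable and $$\mathbb{E}[\phi_k]\le\left[\left(\frac{m_2}{m_1}\right)^{1/r}\rho\right]^k\left(\frac{m_2}{m_1}\rho^r\right)^{-1}\phi_0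 .$$ -/

import Mathlib

open MeasureTheory ProbabilityTheory
open scoped Matrix ENNReal

noncomputable section

namespace SPQN

/-- The Euclidean space `ℝ^d`. -/
abbrev E (d : ℕ) : Type := EuclideanSpace ℝ (Fin d)

variable {d n : ℕ}

/-- `f_S = |S|⁻¹ ∑_{i ∈ S} f_i`. -/
def subsampled (f : Fin n → E d → ℝ) (S : Finset (Fin n)) (x : E d) : ℝ :=
  (S.card : ℝ)⁻¹ * ∑ i ∈ S, f i x

/-- The full average `f = n⁻¹ ∑_i f_i`. -/
def average (f : Fin n → E d → ℝ) : E d → ℝ := subsampled f Finset.univ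

/-- The objective `F = f + h`, with values in `ℝ ∪ {+∞}`. -/
def objective (f : Fin n → E d → ℝ) (h : E d → EReal) (x : E d) : EReal :=
  (average f x : EReal) + h x

/-- The Hessian matrix of second partial derivatives. -/
def hessian (g : E d → ℝ) (x : E d) : Matrix (Fin d) (Fin d) ℝ :=
  Matrix.of fun a b =>
    fderiv ℝ (fderiv ℝ g) x (EuclideanSpace.single a 1) (EuclideanSpace.single b 1)

/-- `a I ⪯ B ⪯ b I` in the Loewner order. -/
def LoewnerBetween (a b : ℝ) (B : Matrix (Fin d) (Fin d) ℝ) : Prop :=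
  (B - a • (1 : Matrix (Fin d) (Fin d) ℝ)).PosSemidef ∧
    (b • (1 : Matrix (Fin d) (Fin d) ℝ) - B).PosSemidef

/-- `‖v‖_B² = vᵀ B v`. -/
def normSq (B : Matrix (Fin d) (Fin d) ℝ) (v : E d) : ℝ :=
  v.ofLp ⬝ᵥ (B *ᵥ v.ofLp)

/-- `h : ℝ^d → ℝ ∪ {+∞}` is proper, convex and lower semicontinuous. -/
structure ProperConvexLSC (h : E d → EReal) : Prop where
  ne_bot : ∀ x, h x ≠ ⊥
  exists_ne_top : ∃ x, h x ≠ ⊤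
  convex : ∀ x y : E d, ∀ a b : ℝ, 0 ≤ a → 0 ≤ b → a + b = 1 →
    h (a • x + b • y) ≤ (a : EReal) * h x + (b : EReal) * h y
  lsc : LowerSemicontinuous h

/-- Each `f_i` is `C²`, and `μ I ⪯ ∇²f_S(x) ⪯ L I` for all `x` and all nonempty `S ⊆ [n]`. -/
structure HessianBounds (f : Fin n → E d → ℝ) (μ L : ℝ) : Prop where
  contDiff : ∀ i, ContDiff ℝ 2 (f i)
  bounds : ∀ S : Finset (Fin n), S.Nonempty → ∀ x : E d,
    LoewnerBetween μ L (hessian (subsampled f S) x)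

/-- The compact representation of the L-BFGS matrix built from the correction pairs
`(s_1, y_1), …, (s_m, y_m)`, listed from the oldest to the latest:
`σ₀ I - [σ₀ S  Y] [σ₀ SᵀS  L; Lᵀ  -D]⁻¹ [σ₀ Sᵀ; Yᵀ]`, with `σ₀ = y_mᵀ y_m / y_mᵀ s_m`.
For the empty list (with `σ₀ = 1`) it is the identity. -/
def lbfgs (ps : List (E d × E d)) : Matrix (Fin d) (Fin d) ℝ :=
  let m := ps.length
  let σ : ℝ := match ps.getLast? with
    | none => 1
    | some q => (q.2.ofLp ⬝ᵥ q.2.ofLp) / (q.2.ofLp ⬝ᵥ q.1.ofLp)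
  let s : Fin m → Fin d → ℝ := fun j => (ps.get j).1.ofLp
  let y : Fin m → Fin d → ℝ := fun j => (ps.get j).2.ofLp
  let S : Matrix (Fin d) (Fin m) ℝ := Matrix.of fun a j => s j a
  let Y : Matrix (Fin d) (Fin m) ℝ := Matrix.of fun a j => y j a
  let D : Matrix (Fin m) (Fin m) ℝ := Matrix.diagonal fun j => s j ⬝ᵥ y j
  let Lo : Matrix (Fin m) (Fin m) ℝ := Matrix.of fun i j => if j < i then s i ⬝ᵥ y j else 0
  σ • (1 : Matrix (Fin d) (Fin d) ℝ) -
    Matrix.fromCols (σ • S) Y * (Matrix.fromBlocks (σ • (Sᵀ * S)) Lo Loᵀ (-D))⁻¹ *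
      Matrix.fromRows (σ • Sᵀ) Yᵀ

/-- The averaged iterates: `x̄^0 = 0` and `x̄^t = r⁻¹ ∑_{j = tr-r+1}^{tr} x_j` for `t ≥ 1`. -/
def xbar (r : ℕ) (x : ℕ → E d) : ℕ → E d
  | 0 => 0
  | t + 1 => (r : ℝ)⁻¹ • ∑ j ∈ Finset.Ioc (t * r) ((t + 1) * r), x j

/-- The correction pair `(s^t, y^t)` (for `t ≥ 1`):
`s^t = x̄^t - x̄^{t-1}` and `y^t = ∇²f_{S^t}(x̄^t) s^t`. -/
def correctionPair (f : Fin n → E d → ℝ) (r : ℕ) (S : ℕ → Finset (Fin n)) (x : ℕ → E d)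
    (t : ℕ) : E d × E d :=
  let s : E d := xbar r x t - xbar r x (t - 1)
  (s, WithLp.toLp 2 (hessian (subsampled f (S t)) (xbar r x t) *ᵥ s.ofLp))

/-- The correction pairs in memory after `t` updates, from the oldest to the latest. At most the
`l` latest pairs are kept; a pair is stored only if it satisfies the curvature condition
`sᵀ y > 0` (under the Hessian bounds, this discards precisely the pairs with `s = 0`). -/
def memory (f : Fin n → E d → ℝ) (r l : ℕ) (S : ℕ → Finset (Fin n)) (x : ℕ → E d) :
    ℕ → List (E d × E d)
  | 0 => []
  | t + 1 =>
    let q := correctionPair f r S x (t + 1)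
    if 0 < q.1.ofLp ⬝ᵥ q.2.ofLp then (memory f r l S x t ++ [q]).rtake l
    else memory f r l S x t

/-- The metric `B_k`: the identity for `k < r`, and the L-BFGS matrix `B^t`, `t = ⌊k / r⌋`,
for `k ≥ r`. It depends only on `x_0, …, x_k` and `S^1, …, S^t`. -/
def metric (f : Fin n → E d → ℝ) (r l : ℕ) (S : ℕ → Finset (Fin n)) (x : ℕ → E d) (k : ℕ) :
    Matrix (Fin d) (Fin d) ℝ :=
  if k < r then 1 else lbfgs (memory f r l S x (k / r))

/-- The L-SVRG gradient estimator `∇f_i(x) - ∇f_i(w) + ∇f(w)`. -/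
def svrgGradient (f : Fin n → E d → ℝ) (i : Fin n) (x w : E d) : E d :=
  gradient (f i) x - gradient (f i) w + gradient (average f) w

/-- The objective of the subproblem:
`z ↦ vᵀ(z - x) + (2η)⁻¹ ‖z - x‖_B² + h(z)`. -/
def subproblem (h : E d → EReal) (η : ℝ) (B : Matrix (Fin d) (Fin d) ℝ) (x v z : E d) : EReal :=
  ((inner ℝ v (z - x) + 1 / (2 * η) * normSq B (z - x) : ℝ) : EReal) + h z

/-- `(x_k)`, `(w_k)` are the iterates and the reference points that the algorithm with constant
step size `η`, update frequency `r` and memory `l` produces from the starting point `x0` when the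
sampled indices are `i_k`, the outcomes of the coin flips are `c_k` and the sampled Hessian
batches are `S^t`. -/
structure IsRun (f : Fin n → E d → ℝ) (h : E d → EReal) (η : ℝ) (r l : ℕ) (x0 : E d)
    (i : ℕ → Fin n) (c : ℕ → Bool) (S : ℕ → Finset (Fin n)) (x w : ℕ → E d) : Prop where
  x_zero : x 0 = x0
  w_zero : w 0 = x0
  x_succ : ∀ k z, subproblem h η (metric f r l S x k) (x k) (svrgGradient f (i k) (x k) (w k))
      (x (k + 1)) ≤
    subproblem h η (metric f r l S x k) (x k) (svrgGradient f (i k) (x k) (w k)) z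
  w_succ : ∀ k, w (k + 1) = if c k = true then x k else w k

/-- The randomness of the algorithm: the indices `i_k` are uniform on `[n]`, the coins `c_k` show
`true` with probability `p`, the Hessian batches `S^t` are nonempty subsets of `[n]` (of any law),
and all these random variables are mutually independent. -/
structure IsSampling {Ω : Type*} [MeasurableSpace Ω] (P : Measure Ω) (p : ℝ)
    (i : ℕ → Ω → Fin n) (c : ℕ → Ω → Bool) (S : ℕ → Ω → Finset (Fin n)) : Prop where
  measurable_index : ∀ k j, MeasurableSet {ω | i k ω = j}
  measurable_coin : ∀ k b, MeasurableSet {ω | c k ω = b}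
  measurable_batch : ∀ t T, MeasurableSet {ω | S t ω = T}
  index_law : ∀ k j, P {ω | i k ω = j} = (n : ℝ≥0∞)⁻¹
  coin_law : ∀ k, P {ω | c k ω = true} = ENNReal.ofReal p
  batch_nonempty : ∀ᵐ ω ∂P, ∀ t, (S t ω).Nonempty
  indep : iIndep
    (Sum.elim (fun k : ℕ => MeasurableSpace.comap (i k) ⊤)
      (Sum.elim (fun k : ℕ => MeasurableSpace.comap (c k) ⊤)
        (fun t : ℕ => MeasurableSpace.comap (S t) ⊤))) P

/-- The Lyapunov function
`‖x - x*‖_B² + A η² (F(w) - F(x*)) + 2 η (F(x) - F(x*))`, with values in `[0, ∞]`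
(it is `∞` if `F(x)` or `F(w)` is). -/
def lyapunov (F : E d → EReal) (xs : E d) (A η : ℝ) (B : Matrix (Fin d) (Fin d) ℝ)
    (x w : E d) : ℝ≥0∞ :=
  ENNReal.ofReal (normSq B (x - xs)) + ENNReal.ofReal (A * η ^ 2) * (F w - F xs).toENNReal +
    ENNReal.ofReal (2 * η) * (F x - F xs).toENNReal

end SPQN

end

/-!
One step in a fixed metric `B` with `m₁ I ⪯ B ⪯ m₂ I` contracts the Lyapunov function in the mean.
The Hessian bounds give quadratic upper and lower bounds on `f` along segments
(`le_quadratic_of_hessian`, `quadratic_le_of_hessian`); with the three-point inequality of the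
proximal subproblem (`ProperConvexLSC.prox_three_point`) and `η ≤ m₁ / L` they yield
`‖x⁺ - x*‖_B² + 2η (F(x⁺) - F*) ≤ ‖x - x*‖_B² - ημ ‖x - x*‖² + 2η ⟪∇f(x) - v, x⁺ - x*⟫`
(`prox_descent`). To average the last term over the sampled index, `x⁺` is compared with the proximal
point `y` of the exact gradient: the noise has mean zero, so `⟪∇f(x) - v, y - x*⟫` averages to zero,
and `⟪∇f(x) - v, x⁺ - y⟫ ≤ (η / m₁) ‖∇f(x) - v‖²` by stability of the proximal map. The variance is
at most `4L (F(x) - F* + F(w) - F*)` (`variance_svrgGradient_le`), by cocoercivity of each `∇f_i`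
and because `-∇f(x*)` is a subgradient of `h` at `x*`. The coin turns `F(w) - F*` into
`p (F(x) - F*) + (1 - p) (F(w) - F*)`, and the conditions on `η`, `A` and `ρ` are what makes every
coefficient shrink by the factor `ρ` (`mean_lyapunov_le`).

For the expectation, all random choices up to step `k` form a history with finitely many values, of
which `x_0, …, x_k`, `w_k` and `B_k` are almost surely functions because proximal points are unique
(`exists_eq_history`). The index and the coin of step `k` are independent of the history, so they
can be averaged first (`IsSampling.lintegral_step`).

The metric changes only at multiples of `r`, each time at the cost of a factor `m₂ / m₁`. Hence
`𝔼 φ_k ≤ (m₂ / m₁) ^ ⌊k / r⌋ ρ ^ k φ_0` (`lintegral_lyapunov_le`), which is at most the stated bound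
since `(m₂ / m₁) ρ ^ r < 1` (`pow_div_mul_pow_le`). An infinite value of
`F` at `x_k` or `w_k` makes the right-hand side of the one-step inequality infinite
(`lyapunov_eq_top`), so the starting point need not lie in the domain of `h`.
-/

namespace SPQN

variable {d n : ℕ}

/-! ### Smoothness and strong convexity from the Hessian bounds -/

/-- Taylor's inequality of second order on `[0, 1]`. -/
lemma le_add_deriv_add_half {φ φ' φ'' : ℝ → ℝ} {C : ℝ} (h1 : ∀ t, HasDerivAt φ (φ' t) t)
    (h2 : ∀ t, HasDerivAt φ' (φ'' t) t) (hC : ∀ t, φ'' t ≤ C) :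
    φ 1 ≤ φ 0 + φ' 0 + C / 2 := by
  have hd : ∀ t, HasDerivAt (fun t => φ' t - C * t) (φ'' t - C) t := fun t => by
    simpa using (h2 t).fun_sub ((hasDerivAt_id t).const_mul C)
  have ha : Antitone (fun t => φ' t - C * t) := antitone_of_hasDerivAt_nonpos hd
    (fun t => by simpa using hC t)
  have he : ∀ t, HasDerivAt (fun t => φ t - t * φ' 0 - C * t ^ 2 / 2) (φ' t - φ' 0 - C * t) t :=
    fun t => by
      have := ((h1 t).sub ((hasDerivAt_id t).mul_const (φ' 0))).sub
        ((((hasDerivAt_id t).pow 2).const_mul C).div_const 2)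
      refine this.congr_deriv ?_
      simp; ring
  have hb : AntitoneOn (fun t => φ t - t * φ' 0 - C * t ^ 2 / 2) (Set.Ici 0) := by
    refine antitoneOn_of_hasDerivWithinAt_nonpos (convex_Ici 0)
      (fun t _ => (he t).continuousAt.continuousWithinAt)
      (fun t _ => (he t).hasDerivWithinAt) fun t ht => ?_
    have := ha (show (0 : ℝ) ≤ t from interior_subset ht)
    simp only [mul_zero, sub_zero] at this
    linarith
  have := hb (Set.mem_Ici.2 le_rfl) (Set.mem_Ici.2 zero_le_one) zero_le_one
  norm_num at this
  linarith

lemma dotProduct_hessian_mulVec (g : E d → ℝ) (x u : E d) :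
    u.ofLp ⬝ᵥ (hessian g x *ᵥ u.ofLp) = fderiv ℝ (fderiv ℝ g) x u u := by
  have hu : u = ∑ a, u.ofLp a • EuclideanSpace.single a (1 : ℝ) := by
    ext b
    simp [Finset.sum_apply, Pi.single_apply]
  conv_rhs => rw [hu]
  simp only [map_sum, map_smul, sum_apply, smul_apply,
    smul_eq_mul, dotProduct, Matrix.mulVec, hessian, Matrix.of_apply, Finset.mul_sum]
  rw [Finset.sum_comm]
  refine Finset.sum_congr rfl fun a _ => Finset.sum_congr rfl fun b _ => ?_
  ring

lemma ofLp_dotProduct_self (u : E d) : u.ofLp ⬝ᵥ u.ofLp = ‖u‖ ^ 2 := by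
  rw [EuclideanSpace.real_norm_sq_eq]
  simp [dotProduct, sq]

lemma LoewnerBetween.le_normSq {a b : ℝ} {B : Matrix (Fin d) (Fin d) ℝ}
    (hB : LoewnerBetween a b B) (u : E d) : a * ‖u‖ ^ 2 ≤ normSq B u := by
  have := hB.1.dotProduct_mulVec_nonneg u.ofLp
  simp only [star_trivial, Matrix.sub_mulVec, Matrix.smul_mulVec, Matrix.one_mulVec,
    dotProduct_sub, dotProduct_smul, ofLp_dotProduct_self, smul_eq_mul] at this
  unfold normSq
  linarith

lemma LoewnerBetween.normSq_le {a b : ℝ} {B : Matrix (Fin d) (Fin d) ℝ}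
    (hB : LoewnerBetween a b B) (u : E d) : normSq B u ≤ b * ‖u‖ ^ 2 := by
  have := hB.2.dotProduct_mulVec_nonneg u.ofLp
  simp only [star_trivial, Matrix.sub_mulVec, Matrix.smul_mulVec, Matrix.one_mulVec,
    dotProduct_sub, dotProduct_smul, ofLp_dotProduct_self, smul_eq_mul] at this
  unfold normSq
  linarith

lemma hasDerivAt_comp_line {g : E d → ℝ} (hg : ContDiff ℝ 2 g) (x u : E d) (t : ℝ) :
    HasDerivAt (fun t : ℝ => g (x + t • u)) (fderiv ℝ g (x + t • u) u) t := by
  have hl : HasDerivAt (fun t : ℝ => x + t • u) u t := by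
    simpa using ((hasDerivAt_id t).smul_const u).const_add x
  exact ((hg.differentiable (by norm_num)) (x + t • u)).hasFDerivAt.comp_hasDerivAt t hl

lemma hasDerivAt_fderiv_comp_line {g : E d → ℝ} (hg : ContDiff ℝ 2 g) (x u : E d) (t : ℝ) :
    HasDerivAt (fun t : ℝ => fderiv ℝ g (x + t • u) u)
      (fderiv ℝ (fderiv ℝ g) (x + t • u) u u) t := by
  have hl : HasDerivAt (fun t : ℝ => x + t • u) u t := by
    simpa using ((hasDerivAt_id t).smul_const u).const_add x
  have hd : Differentiable ℝ (fderiv ℝ g) :=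
    (hg.fderiv_right (m := 1) (by norm_num)).differentiable (by norm_num)
  have hc : HasDerivAt (fun t : ℝ => fderiv ℝ g (x + t • u))
      (fderiv ℝ (fderiv ℝ g) (x + t • u) u) t := (hd (x + t • u)).hasFDerivAt.comp_hasDerivAt t hl
  exact (ContinuousLinearMap.apply ℝ ℝ u).hasFDerivAt.comp_hasDerivAt t hc

lemma le_quadratic_of_hessian {g : E d → ℝ} (hg : ContDiff ℝ 2 g) {a b : ℝ}
    (hH : ∀ x, LoewnerBetween a b (hessian g x)) (x z : E d) :
    g z ≤ g x + inner ℝ (gradient g x) (z - x) + b / 2 * ‖z - x‖ ^ 2 := by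
  have := le_add_deriv_add_half (hasDerivAt_comp_line hg x (z - x))
    (hasDerivAt_fderiv_comp_line hg x (z - x)) (C := b * ‖z - x‖ ^ 2) fun t => by
      rw [← dotProduct_hessian_mulVec]
      exact (hH _).normSq_le _
  simp only [one_smul, zero_smul, add_zero, add_sub_cancel] at this
  rw [gradient, InnerProductSpace.toDual_symm_apply]
  linarith

lemma quadratic_le_of_hessian {g : E d → ℝ} (hg : ContDiff ℝ 2 g) {a b : ℝ}
    (hH : ∀ x, LoewnerBetween a b (hessian g x)) (x z : E d) :
    g x + inner ℝ (gradient g x) (z - x) + a / 2 * ‖z - x‖ ^ 2 ≤ g z := by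
  have := le_add_deriv_add_half (fun t => (hasDerivAt_comp_line hg x (z - x) t).neg)
    (fun t => (hasDerivAt_fderiv_comp_line hg x (z - x) t).neg) (C := -(a * ‖z - x‖ ^ 2))
    fun t => by
      rw [← dotProduct_hessian_mulVec]
      exact neg_le_neg ((hH _).le_normSq _)
  simp only [Pi.neg_apply, one_smul, zero_smul, add_zero, add_sub_cancel] at this
  rw [gradient, InnerProductSpace.toDual_symm_apply]
  linarith

/-- Cocoercivity of the gradient of a convex `b`-smooth function, from the value of
`g - ⟪∇g y, ·⟫` after a gradient step of length `1 / b` from `x`. -/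
lemma norm_gradient_sub_sq_le {g : E d → ℝ} (hg : ContDiff ℝ 2 g) {a b : ℝ} (ha : 0 ≤ a)
    (hb : 0 < b) (hH : ∀ x, LoewnerBetween a b (hessian g x)) (x y : E d) :
    ‖gradient g x - gradient g y‖ ^ 2 ≤
      2 * b * (g x - g y - inner ℝ (gradient g y) (x - y)) := by
  set δ := gradient g x - gradient g y with hδ
  set z := x - b⁻¹ • δ with hz
  have h1 := le_quadratic_of_hessian hg hH x z
  have h2 := quadratic_le_of_hessian hg hH y z
  have h3 : 0 ≤ a / 2 * ‖z - y‖ ^ 2 := by positivity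
  have e1 : z - x = -(b⁻¹ • δ) := by rw [hz]; abel
  have e2 : z - y = (x - y) - b⁻¹ • δ := by rw [hz]; abel
  have e3 : inner ℝ (gradient g x) δ - inner ℝ (gradient g y) δ = ‖δ‖ ^ 2 := by
    rw [← inner_sub_left, ← hδ, real_inner_self_eq_norm_sq]
  rw [e2, inner_sub_right, inner_smul_right] at h2
  rw [e1, inner_neg_right, inner_smul_right, norm_neg, norm_smul, mul_pow, Real.norm_eq_abs,
    sq_abs] at h1
  have e4 : b / 2 * (b⁻¹ ^ 2 * ‖δ‖ ^ 2) = b⁻¹ / 2 * ‖δ‖ ^ 2 := by field_simp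
  have h4 : b⁻¹ / 2 * ‖δ‖ ^ 2 ≤ g x - g y - inner ℝ (gradient g y) (x - y) := by
    rw [e4] at h1
    rw [e2] at h3
    have : b⁻¹ * inner ℝ (gradient g x) δ - b⁻¹ * inner ℝ (gradient g y) δ = b⁻¹ * ‖δ‖ ^ 2 := by
      rw [← mul_sub, e3]
    linarith
  calc ‖δ‖ ^ 2 = 2 * b * (b⁻¹ / 2 * ‖δ‖ ^ 2) := by field_simp
    _ ≤ _ := by gcongr

section Average

variable {f : Fin n → E d → ℝ} {μ L : ℝ}

lemma subsampled_singleton (f : Fin n → E d → ℝ) (j : Fin n) : subsampled f {j} = f j := by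
  ext x; simp [subsampled]

lemma average_apply (f : Fin n → E d → ℝ) (x : E d) :
    average f x = (n : ℝ)⁻¹ * ∑ j, f j x := by
  simp [average, subsampled]

lemma HessianBounds.contDiff_average (hf : HessianBounds f μ L) : ContDiff ℝ 2 (average f) := by
  have : average f = fun x => (n : ℝ)⁻¹ * ∑ j, f j x := funext (average_apply f)
  rw [this]
  exact contDiff_const.mul (ContDiff.sum fun j _ => hf.contDiff j)

lemma HessianBounds.hessian_component (hf : HessianBounds f μ L) (j : Fin n) (x : E d) :
    LoewnerBetween μ L (hessian (f j) x) := by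
  simpa [subsampled_singleton] using hf.bounds {j} (Finset.singleton_nonempty j) x

lemma HessianBounds.hessian_average [NeZero n] (hf : HessianBounds f μ L) (x : E d) :
    LoewnerBetween μ L (hessian (average f) x) :=
  hf.bounds Finset.univ Finset.univ_nonempty x

lemma HessianBounds.gradient_average (hf : HessianBounds f μ L) (x : E d) :
    gradient (average f) x = (n : ℝ)⁻¹ • ∑ j, gradient (f j) x := by
  have h1 : HasFDerivAt (fun x => (n : ℝ)⁻¹ * ∑ j, f j x)
      ((n : ℝ)⁻¹ • ∑ j, fderiv ℝ (f j) x) x :=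
    (HasFDerivAt.fun_sum fun j _ =>
      ((hf.contDiff j).differentiable (by norm_num) x).hasFDerivAt).const_mul _
  have h2 : fderiv ℝ (average f) x = (n : ℝ)⁻¹ • ∑ j, fderiv ℝ (f j) x := by
    rw [← h1.fderiv]; congr 1; exact funext (average_apply f)
  simp only [gradient, h2, map_smul, map_sum]

end Average

/-! ### The proximal step -/

lemma normSq_add_smul (B : Matrix (Fin d) (Fin d) ℝ) (a u : E d) (t : ℝ) :
    normSq B (a + t • u) = normSq B a + t * (normSq B (a + u) - normSq B a - normSq B u) +
      t ^ 2 * normSq B u := by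
  simp only [normSq, WithLp.ofLp_add, WithLp.ofLp_smul, Matrix.mulVec_add, Matrix.mulVec_smul,
    add_dotProduct, dotProduct_add, smul_dotProduct, dotProduct_smul, smul_eq_mul]
  ring

lemma normSq_neg (B : Matrix (Fin d) (Fin d) ℝ) (u : E d) : normSq B (-u) = normSq B u := by
  simp [normSq, Matrix.mulVec_neg]

lemma continuous_normSq (B : Matrix (Fin d) (Fin d) ℝ) : Continuous (normSq B) := by
  unfold normSq dotProduct Matrix.mulVec dotProduct
  fun_prop

section Minimizer

variable {h : E d → EReal}

lemma ProperConvexLSC.exists_eq_coe (hh : ProperConvexLSC h) {x : E d} (hx : h x ≠ ⊤) :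
    ∃ a : ℝ, h x = a :=
  ⟨(h x).toReal, (EReal.coe_toReal hx (hh.ne_bot x)).symm⟩

/-- First-order optimality: if `z` minimizes `q + h`, then the increase of `h` towards `y`
compensates any first-order bound `a` on the increase of `q` along the segment from `z` to `y`. -/
lemma ProperConvexLSC.le_add_of_isMin (hh : ProperConvexLSC h) {q : E d → ℝ} {z y : E d}
    (hmin : ∀ u, (q z : EReal) + h z ≤ (q u : EReal) + h u) {hz hy a C : ℝ}
    (ez : h z = hz) (ey : h y = hy)
    (hq : ∀ t : ℝ, 0 < t → t < 1 → q (z + t • (y - z)) ≤ q z + t * a + t ^ 2 * C) :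
    hz ≤ a + hy := by
  have key : ∀ t : ℝ, 0 < t → t < 1 → hz ≤ a + hy + t * C := by
    intro t h0 h1
    have e : z + t • (y - z) = (1 - t) • z + t • y := by module
    have hc := hh.convex z y (1 - t) t (by linarith) h0.le (by ring)
    rw [← e, ez, ey] at hc
    have h2 : ((q z + hz : ℝ) : EReal) ≤
        ((q (z + t • (y - z)) + ((1 - t) * hz + t * hy) : ℝ) : EReal) := by
      have := (hmin (z + t • (y - z))).trans (add_le_add_right hc _)
      rw [ez] at this
      exact_mod_cast this
    have h3 := EReal.coe_le_coe_iff.1 h2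
    have h4 := hq t h0 h1
    have h5 : t * hz ≤ t * (a + hy + t * C) := by nlinarith
    exact le_of_mul_le_mul_left h5 h0
  have ht : Filter.Tendsto (fun t : ℝ => a + hy + t * C) (nhdsWithin 0 (Set.Ioi 0))
      (nhds (a + hy + 0 * C)) :=
    ((by fun_prop : Continuous fun t : ℝ => a + hy + t * C).tendsto 0).mono_left
      nhdsWithin_le_nhds
  rw [zero_mul, add_zero] at ht
  refine ge_of_tendsto ht ?_
  filter_upwards [Ioo_mem_nhdsGT (zero_lt_one (α := ℝ))] with t ht using key t ht.1 ht.2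

lemma ProperConvexLSC.ne_top_of_isMin (hh : ProperConvexLSC h) {q : E d → ℝ} {z : E d}
    (hmin : ∀ u, (q z : EReal) + h z ≤ (q u : EReal) + h u) : h z ≠ ⊤ := by
  obtain ⟨y, hy⟩ := hh.exists_ne_top
  obtain ⟨b, hb⟩ := hh.exists_eq_coe hy
  intro hz
  have := hmin y
  rw [hz, hb, EReal.coe_add_top, top_le_iff, ← EReal.coe_add] at this
  exact EReal.coe_ne_top _ this

/-- A convex lower semicontinuous function with an affine minorant has a proximal point for every
positive definite metric. -/
lemma ProperConvexLSC.exists_prox (hh : ProperConvexLSC h) {xs g : E d} {hs : ℝ}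
    (es : h xs = hs) (haff : ∀ z, ((hs - inner ℝ g (z - xs) : ℝ) : EReal) ≤ h z)
    {η a b : ℝ} (hη : 0 < η) (ha : 0 < a) {B : Matrix (Fin d) (Fin d) ℝ}
    (hB : LoewnerBetween a b B) (x v : E d) :
    ∃ z, ∀ y, subproblem h η B x v z ≤ subproblem h η B x v y := by
  set q : E d → ℝ := fun z => inner ℝ v (z - x) + 1 / (2 * η) * normSq B (z - x) with hq
  have hqc : Continuous q := by
    have := (continuous_normSq B).comp (continuous_id.sub (continuous_const (y := x)))
    have h2 : Continuous fun z : E d => normSq B (z - x) := this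
    rw [hq]
    fun_prop
  have hlsc : LowerSemicontinuous (fun z => (q z : EReal) + h z) :=
    (continuous_coe_real_ereal.comp hqc).lowerSemicontinuous.add' hh.lsc fun z =>
      EReal.continuousAt_add (Or.inl (EReal.coe_ne_top _)) (Or.inl (EReal.coe_ne_bot _))
  set M := q xs + hs with hM
  set e := hs - inner ℝ g (x - xs) with he
  set β := ‖v‖ + ‖g‖ with hβ
  set κ := a / (2 * η) with hκ
  have hκ0 : 0 < κ := by positivity
  set R := max (max ‖xs - x‖ 1) ((β + |M - e| + 1) / κ) with hR
  have hxsR : xs ∈ Metric.closedBall x R := by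
    rw [Metric.mem_closedBall, dist_eq_norm]
    exact (le_max_left _ _).trans (le_max_left _ _)
  obtain ⟨z, hz, hzmin⟩ := (hlsc.lowerSemicontinuousOn _).exists_isMinOn ⟨xs, hxsR⟩
    (isCompact_closedBall x R)
  refine ⟨z, fun y => ?_⟩
  change (q z : EReal) + h z ≤ (q y : EReal) + h y
  by_cases hy : y ∈ Metric.closedBall x R
  · exact hzmin hy
  -- outside the ball the quadratic term dominates, and the value exceeds the one at `xs`
  refine (hzmin hxsR).trans ?_
  change (q xs : EReal) + h xs ≤ (q y : EReal) + h y
  rw [es]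
  refine le_trans ?_ (add_le_add_right (haff y) _)
  rw [← EReal.coe_add, ← EReal.coe_add, EReal.coe_le_coe_iff]
  rw [Metric.mem_closedBall, dist_eq_norm, not_le] at hy
  set s := ‖y - x‖ with hs'
  have hs1 : 1 ≤ s := ((le_max_right _ _).trans (le_max_left _ _)).trans hy.le
  have hs2 : β + |M - e| + 1 ≤ κ * s := by
    have := (le_max_right _ _).trans hy.le
    rw [div_le_iff₀ hκ0] at this
    linarith
  have hv : -(‖v‖ * s) ≤ inner ℝ v (y - x) := neg_le_of_abs_le (abs_real_inner_le_norm _ _)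
  have hg : inner ℝ g (y - x) ≤ ‖g‖ * s := real_inner_le_norm _ _
  have hN : κ * s ^ 2 ≤ 1 / (2 * η) * normSq B (y - x) := by
    have := mul_le_mul_of_nonneg_left (hB.le_normSq (y - x))
      (by positivity : 0 ≤ 1 / (2 * η))
    rw [hκ]
    calc a / (2 * η) * s ^ 2 = 1 / (2 * η) * (a * ‖y - x‖ ^ 2) := by rw [hs']; ring
      _ ≤ _ := this
  have esp : inner ℝ g (y - xs) = inner ℝ g (y - x) + inner ℝ g (x - xs) := by
    rw [← inner_add_right]; congr 1; abel
  have hM' := le_abs_self (M - e)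
  have h0 := abs_nonneg (M - e)
  have : (β + |M - e| + 1) * s ≤ κ * s ^ 2 := by nlinarith
  have : (|M - e| + 1) * 1 ≤ (|M - e| + 1) * s := by gcongr
  change M ≤ q y + _
  rw [esp]
  simp only [hq]
  nlinarith

/-- The three-point inequality: the proximal subproblem is strongly convex in the metric `B`. -/
lemma ProperConvexLSC.prox_three_point (hh : ProperConvexLSC h) {η : ℝ}
    {B : Matrix (Fin d) (Fin d) ℝ} {x v z y : E d}
    (hmin : ∀ u, subproblem h η B x v z ≤ subproblem h η B x v u) {hz hy : ℝ}
    (ez : h z = hz) (ey : h y = hy) :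
    inner ℝ v (z - x) + 1 / (2 * η) * normSq B (z - x) + hz + 1 / (2 * η) * normSq B (y - z) ≤
      inner ℝ v (y - x) + 1 / (2 * η) * normSq B (y - x) + hy := by
  have := hh.le_add_of_isMin
    (q := fun u => inner ℝ v (u - x) + 1 / (2 * η) * normSq B (u - x)) hmin ez ey
    (a := inner ℝ v (y - x) + 1 / (2 * η) * normSq B (y - x) -
      (inner ℝ v (z - x) + 1 / (2 * η) * normSq B (z - x)) - 1 / (2 * η) * normSq B (y - z))
    (C := 1 / (2 * η) * normSq B (y - z)) fun t _ _ => by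
      have e1 : z + t • (y - z) - x = (z - x) + t • (y - z) := by abel
      have e2 : inner ℝ v (y - x) = inner ℝ v (z - x) + inner ℝ v (y - z) := by
        rw [← inner_add_right]; congr 1; abel
      simp only [e1, normSq_add_smul B (z - x) (y - z) t, inner_add_right, inner_smul_right,
        sub_add_sub_cancel', e2]
      apply le_of_eq
      ring
  linarith

lemma ProperConvexLSC.prox_stability (hh : ProperConvexLSC h) {η a b : ℝ} (hη : 0 < η)
    {B : Matrix (Fin d) (Fin d) ℝ} (hB : LoewnerBetween a b B) {x v v' z z' : E d}
    (hmin : ∀ u, subproblem h η B x v z ≤ subproblem h η B x v u)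
    (hmin' : ∀ u, subproblem h η B x v' z' ≤ subproblem h η B x v' u) :
    a * ‖z - z'‖ ^ 2 ≤ η * inner ℝ (v' - v) (z - z') := by
  obtain ⟨hz, ez⟩ := hh.exists_eq_coe (hh.ne_top_of_isMin
    (q := fun u => inner ℝ v (u - x) + 1 / (2 * η) * normSq B (u - x)) hmin)
  obtain ⟨hz', ez'⟩ := hh.exists_eq_coe (hh.ne_top_of_isMin
    (q := fun u => inner ℝ v' (u - x) + 1 / (2 * η) * normSq B (u - x)) hmin')
  have h1 := hh.prox_three_point hmin ez ez'
  have h2 := hh.prox_three_point hmin' ez' ez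
  have h3 := hB.le_normSq (z - z')
  rw [← normSq_neg B (z' - z), neg_sub] at h1
  have h4 : inner ℝ (v' - v) (z - z') = inner ℝ v' (z - x) - inner ℝ v' (z' - x) -
      (inner ℝ v (z - x) - inner ℝ v (z' - x)) := by
    rw [← inner_sub_right, ← inner_sub_right, inner_sub_left]
    simp
  have h5 : 2 * (1 / (2 * η) * normSq B (z - z')) ≤ inner ℝ (v' - v) (z - z') := by
    rw [h4]; linarith
  have h6 : 2 * (1 / (2 * η) * normSq B (z - z')) = η⁻¹ * normSq B (z - z') := by
    field_simp
  rw [h6, inv_mul_le_iff₀ hη] at h5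
  linarith

lemma ProperConvexLSC.prox_unique (hh : ProperConvexLSC h) {η a b : ℝ} (hη : 0 < η) (ha : 0 < a)
    {B : Matrix (Fin d) (Fin d) ℝ} (hB : LoewnerBetween a b B) {x v z z' : E d}
    (hmin : ∀ u, subproblem h η B x v z ≤ subproblem h η B x v u)
    (hmin' : ∀ u, subproblem h η B x v z' ≤ subproblem h η B x v u) : z = z' := by
  have := hh.prox_stability hη hB hmin hmin'
  rw [sub_self, inner_zero_left, mul_zero] at this
  have h2 : ‖z - z'‖ ^ 2 ≤ 0 := by
    by_contra hc
    push Not at hc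
    nlinarith
  have h3 : ‖z - z'‖ = 0 := by nlinarith [norm_nonneg (z - z')]
  exact sub_eq_zero.1 (norm_eq_zero.1 h3)

/-- The effect of perturbing the gradient on the proximal point. -/
lemma ProperConvexLSC.inner_prox_sub_le (hh : ProperConvexLSC h) {η a b : ℝ} (hη : 0 < η)
    (ha : 0 < a) {B : Matrix (Fin d) (Fin d) ℝ} (hB : LoewnerBetween a b B) {x v v' z z' : E d}
    (hmin : ∀ u, subproblem h η B x v z ≤ subproblem h η B x v u)
    (hmin' : ∀ u, subproblem h η B x v' z' ≤ subproblem h η B x v' u) :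
    inner ℝ (v' - v) (z - z') ≤ η / a * ‖v' - v‖ ^ 2 := by
  have h1 := hh.prox_stability hη hB hmin hmin'
  have h2 := real_inner_le_norm (v' - v) (z - z')
  set s := ‖z - z'‖ with hs
  set δ := ‖v' - v‖ with hδ
  have hs0 : 0 ≤ s := norm_nonneg _
  have hδ0 : 0 ≤ δ := norm_nonneg _
  have h3 : a * s ^ 2 ≤ η * δ * s := by nlinarith
  have h4 : a * s ≤ η * δ := by
    rcases hs0.eq_or_lt with h | h
    · rw [← h]; simp; positivity
    · exact le_of_mul_le_mul_right (by nlinarith) h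
  have h5 : s ≤ η / a * δ := by
    rw [div_mul_eq_mul_div, le_div_iff₀ ha]; linarith
  calc _ ≤ δ * s := h2
    _ ≤ δ * (η / a * δ) := by gcongr
    _ = _ := by ring

end Minimizer

/-! ### One step of the method in a fixed metric -/

section OneStep

variable {f : Fin n → E d → ℝ} {h : E d → EReal} {μ L : ℝ} {xs : E d}

lemma ProperConvexLSC.minimizer_ne_top (hh : ProperConvexLSC h)
    (hxs : ∀ z, objective f h xs ≤ objective f h z) : h xs ≠ ⊤ :=
  hh.ne_top_of_isMin (q := average f) hxs

/-- At the minimizer, `-∇f(x*)` is a subgradient of `h`. -/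
lemma affine_minorant [NeZero n] (hh : ProperConvexLSC h) (hf : HessianBounds f μ L)
    (hxs : ∀ z, objective f h xs ≤ objective f h z) {hs : ℝ} (es : h xs = hs) (z : E d) :
    ((hs - inner ℝ (gradient (average f) xs) (z - xs) : ℝ) : EReal) ≤ h z := by
  by_cases hz : h z = ⊤
  · simp [hz]
  obtain ⟨b, hb⟩ := hh.exists_eq_coe hz
  rw [hb, EReal.coe_le_coe_iff, sub_le_iff_le_add, add_comm]
  refine hh.le_add_of_isMin (q := average f) (C := L / 2 * ‖z - xs‖ ^ 2) hxs es hb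
    fun t _ _ => ?_
  have := le_quadratic_of_hessian hf.contDiff_average hf.hessian_average xs
    (xs + t • (z - xs))
  rw [add_sub_cancel_left, inner_smul_right, norm_smul, mul_pow, Real.norm_eq_abs, sq_abs] at this
  linarith

lemma bregman_le_gap [NeZero n] (hh : ProperConvexLSC h) (hf : HessianBounds f μ L)
    (hxs : ∀ z, objective f h xs ≤ objective f h z) {hs : ℝ} (es : h xs = hs) {z : E d} {hz : ℝ}
    (ez : h z = hz) :
    average f z - average f xs - inner ℝ (gradient (average f) xs) (z - xs) ≤
      average f z + hz - (average f xs + hs) := by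
  have := affine_minorant hh hf hxs es z
  rw [ez, EReal.coe_le_coe_iff] at this
  linarith

lemma mean_norm_gradient_sub_sq_le [NeZero n] (hh : ProperConvexLSC h)
    (hf : HessianBounds f μ L) (hμ : 0 < μ) (hL : 0 < L)
    (hxs : ∀ z, objective f h xs ≤ objective f h z) {hs : ℝ} (es : h xs = hs) {z : E d} {hz : ℝ}
    (ez : h z = hz) :
    (n : ℝ)⁻¹ * ∑ j, ‖gradient (f j) z - gradient (f j) xs‖ ^ 2 ≤
      2 * L * (average f z + hz - (average f xs + hs)) := by
  refine le_trans ?_ (mul_le_mul_of_nonneg_left (bregman_le_gap hh hf hxs es ez) (by positivity))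
  have h1 : ∑ j, ‖gradient (f j) z - gradient (f j) xs‖ ^ 2 ≤
      ∑ j, 2 * L * (f j z - f j xs - inner ℝ (gradient (f j) xs) (z - xs)) :=
    Finset.sum_le_sum fun j _ =>
      norm_gradient_sub_sq_le (hf.contDiff j) hμ.le hL (hf.hessian_component j) z xs
  refine (mul_le_mul_of_nonneg_left h1 (by positivity)).trans_eq ?_
  rw [hf.gradient_average, inner_smul_left, sum_inner, average_apply, average_apply,
    ← Finset.mul_sum, Finset.sum_sub_distrib, Finset.sum_sub_distrib]
  simp only [conj_trivial]
  ring

lemma mean_svrgGradient [NeZero n] (hf : HessianBounds f μ L) (x w : E d) :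
    ∑ j, (gradient (average f) x - svrgGradient f j x w) = 0 := by
  have hn : (n : ℝ) ≠ 0 := Nat.cast_ne_zero.2 (NeZero.ne n)
  have hs : ∀ y, ∑ j, gradient (f j) y = (n : ℝ) • gradient (average f) y := fun y => by
    rw [hf.gradient_average, smul_inv_smul₀ hn]
  simp only [svrgGradient, Finset.sum_sub_distrib, Finset.sum_add_distrib, hs,
    Finset.sum_const, Finset.card_univ, Fintype.card_fin, ← Nat.cast_smul_eq_nsmul ℝ]
  abel

/-- The second moment is at least the variance. -/
lemma sum_norm_mean_sub_sq_le {ι V : Type*} [Fintype ι] [NormedAddCommGroup V]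
    [InnerProductSpace ℝ V] (a : ι → V) {m : V} (hm : ∑ j, (m - a j) = 0) :
    ∑ j, ‖m - a j‖ ^ 2 ≤ ∑ j, ‖a j‖ ^ 2 := by
  have h1 : ∀ j, ‖a j‖ ^ 2 = ‖m‖ ^ 2 - 2 * inner ℝ m (m - a j) + ‖m - a j‖ ^ 2 := fun j => by
    rw [← norm_sub_sq_real]; simp
  simp only [h1, Finset.sum_add_distrib, Finset.sum_sub_distrib, ← Finset.mul_sum, ← inner_sum, hm,
    inner_zero_right]
  have : 0 ≤ ∑ _j : ι, ‖m‖ ^ 2 := by positivity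
  linarith

lemma variance_svrgGradient_le [NeZero n] (hh : ProperConvexLSC h)
    (hf : HessianBounds f μ L) (hμ : 0 < μ) (hL : 0 < L)
    (hxs : ∀ z, objective f h xs ≤ objective f h z) {hs : ℝ} (es : h xs = hs) {x w : E d}
    {hx hw : ℝ} (ex : h x = hx) (ew : h w = hw) :
    (n : ℝ)⁻¹ * ∑ j, ‖gradient (average f) x - svrgGradient f j x w‖ ^ 2 ≤
      4 * L * ((average f x + hx - (average f xs + hs)) +
        (average f w + hw - (average f xs + hs))) := by
  have h1 := mean_norm_gradient_sub_sq_le hh hf hμ hL hxs es ex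
  have h2 := mean_norm_gradient_sub_sq_le hh hf hμ hL hxs es ew
  have e : ∀ j, gradient (average f) x - svrgGradient f j x w =
      (gradient (average f) x - gradient (average f) w) -
        (gradient (f j) x - gradient (f j) w) := fun j => by
    unfold svrgGradient; abel
  have h3 : ∑ j, ‖gradient (average f) x - svrgGradient f j x w‖ ^ 2 ≤
      ∑ j, ‖gradient (f j) x - gradient (f j) w‖ ^ 2 := by
    have hm := mean_svrgGradient hf x w
    simp only [e] at hm ⊢
    exact sum_norm_mean_sub_sq_le _ hm
  have h4 : ∑ j, ‖gradient (f j) x - gradient (f j) w‖ ^ 2 ≤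
      ∑ j, (2 * ‖gradient (f j) x - gradient (f j) xs‖ ^ 2 +
        2 * ‖gradient (f j) w - gradient (f j) xs‖ ^ 2) := by
    refine Finset.sum_le_sum fun j _ => ?_
    have := norm_sub_le (gradient (f j) x - gradient (f j) xs)
      (gradient (f j) w - gradient (f j) xs)
    rw [sub_sub_sub_cancel_right] at this
    have h0 := norm_nonneg (gradient (f j) x - gradient (f j) w)
    nlinarith [sq_nonneg (‖gradient (f j) x - gradient (f j) xs‖ -
      ‖gradient (f j) w - gradient (f j) xs‖)]
  have h5 := mul_le_mul_of_nonneg_left (h3.trans h4) (by positivity : 0 ≤ (n : ℝ)⁻¹)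
  rw [Finset.sum_add_distrib, ← Finset.mul_sum, ← Finset.mul_sum] at h5
  linarith

lemma prox_descent [NeZero n] (hh : ProperConvexLSC h) (hf : HessianBounds f μ L)
    {m₁ m₂ η : ℝ} (hη : 0 < η) (hL : 0 < L) (hηL : η ≤ m₁ / L)
    {B : Matrix (Fin d) (Fin d) ℝ} (hB : LoewnerBetween m₁ m₂ B) {hs : ℝ} (es : h xs = hs)
    {x v z : E d} {hz : ℝ} (ez : h z = hz)
    (hmin : ∀ u, subproblem h η B x v z ≤ subproblem h η B x v u) :
    normSq B (z - xs) + 2 * η * (average f z + hz - (average f xs + hs)) ≤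
      normSq B (x - xs) - η * μ * ‖x - xs‖ ^ 2 +
        2 * η * inner ℝ (gradient (average f) x - v) (z - xs) := by
  have h1 := hh.prox_three_point hmin ez es
  have h2 := le_quadratic_of_hessian hf.contDiff_average hf.hessian_average x z
  have h3 := quadratic_le_of_hessian hf.contDiff_average hf.hessian_average x xs
  have h4 := hB.le_normSq (z - x)
  rw [← normSq_neg B (xs - z), neg_sub, ← normSq_neg B (xs - x), neg_sub] at h1
  have e1 : ∀ g : E d, inner ℝ g (z - xs) = inner ℝ g (z - x) - inner ℝ g (xs - x) := fun g => by
    rw [← inner_sub_right]; simp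
  rw [norm_sub_rev xs x] at h3
  rw [e1, inner_sub_left, inner_sub_left]
  have h5 : L * ‖z - x‖ ^ 2 ≤ η⁻¹ * normSq B (z - x) := by
    have : L ≤ η⁻¹ * m₁ := by
      rw [le_div_iff₀ hL] at hηL
      rw [← div_eq_inv_mul, le_div_iff₀ hη]; linarith
    calc L * ‖z - x‖ ^ 2 ≤ η⁻¹ * m₁ * ‖z - x‖ ^ 2 := by gcongr
      _ = η⁻¹ * (m₁ * ‖z - x‖ ^ 2) := by ring
      _ ≤ _ := by gcongr
  have e2 : ∀ a : ℝ, 1 / (2 * η) * a = η⁻¹ * a / 2 := fun a => by field_simp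
  simp only [e2] at h1
  have h6 : η⁻¹ * normSq B (z - xs) + 2 * (average f z + hz - (average f xs + hs)) ≤
      η⁻¹ * normSq B (x - xs) - μ * ‖x - xs‖ ^ 2 +
      2 * (inner ℝ (gradient (average f) x) (z - x) - inner ℝ v (z - x) -
        (inner ℝ (gradient (average f) x) (xs - x) - inner ℝ v (xs - x))) := by linarith
  have h7 := mul_le_mul_of_nonneg_left h6 hη.le
  have e3 : ∀ a : ℝ, η * (η⁻¹ * a) = a := fun a => by field_simp
  simp only [mul_add, mul_sub, e3] at h7
  linarith

/-- The mean over the sampled index of the descent inequality. The gradient noise has mean zero, so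
its product with the noiseless proximal point vanishes in the mean, and only its product with the
displacement of the proximal point, of the order of the variance, remains. -/
lemma mean_prox_descent [NeZero n] (hh : ProperConvexLSC h) (hf : HessianBounds f μ L)
    (hμ : 0 < μ) (hL : 0 < L) (hxs : ∀ z, objective f h xs ≤ objective f h z)
    {m₁ m₂ η : ℝ} (hm₁ : 0 < m₁) (hm₂ : 0 < m₂) (hη : 0 < η) (hηL : η ≤ m₁ / L)
    {B : Matrix (Fin d) (Fin d) ℝ} (hB : LoewnerBetween m₁ m₂ B) {hs : ℝ} (es : h xs = hs)
    {x w : E d} {hx hw : ℝ} (ex : h x = hx) (ew : h w = hw) {z : Fin n → E d} {hz : Fin n → ℝ}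
    (ez : ∀ j, h (z j) = hz j)
    (hmin : ∀ j u, subproblem h η B x (svrgGradient f j x w) (z j) ≤
      subproblem h η B x (svrgGradient f j x w) u) :
    (n : ℝ)⁻¹ * ∑ j, (normSq B (z j - xs) +
        2 * η * (average f (z j) + hz j - (average f xs + hs))) ≤
      (1 - η * μ / m₂) * normSq B (x - xs) + 8 * L * η ^ 2 / m₁ *
        ((average f x + hx - (average f xs + hs)) +
          (average f w + hw - (average f xs + hs))) := by
  obtain ⟨y, hy⟩ := hh.exists_prox es (affine_minorant hh hf hxs es) hη hm₁ hB x
    (gradient (average f) x)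
  have hn : (n : ℝ) ≠ 0 := Nat.cast_ne_zero.2 (NeZero.ne n)
  set N := fun j => gradient (average f) x - svrgGradient f j x w with hN
  have hN0 : ∑ j, N j = 0 := mean_svrgGradient hf x w
  have h1 : ∀ j, normSq B (z j - xs) +
        2 * η * (average f (z j) + hz j - (average f xs + hs)) ≤
      (1 - η * μ / m₂) * normSq B (x - xs) +
        2 * η * (inner ℝ (N j) (y - xs) + η / m₁ * ‖N j‖ ^ 2) := fun j => by
    have h2 := prox_descent hh hf hη hL hηL hB es (ez j) (hmin j)
    have h3 := hh.inner_prox_sub_le hη hm₁ hB (hmin j) hy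
    have h4 : η * μ / m₂ * normSq B (x - xs) ≤ η * μ * ‖x - xs‖ ^ 2 := by
      calc η * μ / m₂ * normSq B (x - xs) ≤ η * μ / m₂ * (m₂ * ‖x - xs‖ ^ 2) := by
            gcongr; exact hB.normSq_le _
        _ = _ := by field_simp
    have h5 : inner ℝ (N j) (z j - xs) = inner ℝ (N j) (z j - y) + inner ℝ (N j) (y - xs) := by
      rw [← inner_add_right]; congr 1; abel
    change _ ≤ _ + 2 * η * inner ℝ (N j) (z j - xs) at h2
    change inner ℝ (N j) (z j - y) ≤ η / m₁ * ‖N j‖ ^ 2 at h3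
    have h6 := mul_le_mul_of_nonneg_left h3 (by positivity : 0 ≤ 2 * η)
    rw [h5] at h2
    linarith
  have h2 := mul_le_mul_of_nonneg_left (Finset.sum_le_sum fun j (_ : j ∈ Finset.univ) => h1 j)
    (by positivity : 0 ≤ (n : ℝ)⁻¹)
  refine h2.trans ?_
  rw [Finset.sum_add_distrib, Finset.sum_const, Finset.card_univ, Fintype.card_fin, nsmul_eq_mul,
    ← Finset.mul_sum, Finset.sum_add_distrib, ← sum_inner, hN0, inner_zero_left, ← Finset.mul_sum,
    mul_add, inv_mul_cancel_left₀ hn, zero_add]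
  have h3 := mul_le_mul_of_nonneg_left (variance_svrgGradient_le hh hf hμ hL hxs es ex ew)
    (by positivity : 0 ≤ 2 * η * (η / m₁))
  have e : 2 * η * (η / m₁) * (4 * L * ((average f x + hx - (average f xs + hs)) +
      (average f w + hw - (average f xs + hs)))) = 8 * L * η ^ 2 / m₁ *
        ((average f x + hx - (average f xs + hs)) +
          (average f w + hw - (average f xs + hs))) := by ring
  rw [e] at h3
  refine (add_le_add_iff_left _).2 (le_trans (le_of_eq ?_) h3)
  ring

lemma gap_nonneg (hxs : ∀ z, objective f h xs ≤ objective f h z) {hs : ℝ} (es : h xs = hs)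
    {z : E d} {hz : ℝ} (ez : h z = hz) : 0 ≤ average f z + hz - (average f xs + hs) := by
  have := hxs z
  unfold objective at this
  rw [es, ez, ← EReal.coe_add, ← EReal.coe_add, EReal.coe_le_coe_iff] at this
  linarith

lemma lyapunov_eq_ofReal (hxs : ∀ z, objective f h xs ≤ objective f h z) {A η : ℝ} (hA : 0 ≤ A)
    (hη : 0 ≤ η) {B : Matrix (Fin d) (Fin d) ℝ} {x w : E d} (hN : 0 ≤ normSq B (x - xs))
    {hs hx hw : ℝ} (es : h xs = hs) (ex : h x = hx) (ew : h w = hw) :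
    lyapunov (objective f h) xs A η B x w =
      ENNReal.ofReal (normSq B (x - xs) +
        A * η ^ 2 * (average f w + hw - (average f xs + hs)) +
        2 * η * (average f x + hx - (average f xs + hs))) := by
  have h1 := gap_nonneg hxs es ex
  have h2 := gap_nonneg hxs es ew
  have e : ∀ a b a' b' : ℝ, ((a : EReal) + (b : EReal) - ((a' : EReal) + (b' : EReal))).toENNReal =
      ENNReal.ofReal (a + b - (a' + b')) := fun a b a' b' => by
    rw [← EReal.coe_add, ← EReal.coe_add, ← EReal.coe_sub, EReal.toENNReal_of_ne_top
      (EReal.coe_ne_top _), EReal.toReal_coe]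
  unfold lyapunov objective
  rw [es, ex, ew, e, e, ← ENNReal.ofReal_mul (by positivity), ← ENNReal.ofReal_mul (by positivity),
    ← ENNReal.ofReal_add hN (by positivity), ← ENNReal.ofReal_add (by positivity) (by positivity)]

lemma lyapunov_eq_top (hh : ProperConvexLSC h) (hxs : ∀ z, objective f h xs ≤ objective f h z)
    {A η : ℝ} (hA : 0 < A) (hη : 0 < η) {B : Matrix (Fin d) (Fin d) ℝ} {x w : E d}
    (hxw : h x = ⊤ ∨ h w = ⊤) : lyapunov (objective f h) xs A η B x w = ⊤ := by
  obtain ⟨hs, es⟩ := hh.exists_eq_coe (hh.minimizer_ne_top hxs)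
  have e : ∀ y, h y = ⊤ → (objective f h y - objective f h xs).toENNReal = ⊤ := fun y hy => by
    unfold objective
    rw [hy, es, ← EReal.coe_add, EReal.coe_add_top, EReal.top_sub_coe, EReal.toENNReal_top]
  unfold lyapunov
  rcases hxw with hx | hw
  · rw [e x hx, ENNReal.mul_top (by simpa using hη), add_top]
  · rw [e w hw, ENNReal.mul_top (by simpa using by positivity), add_top, top_add]

lemma lyapunov_le_mul_of_loewner {F : E d → EReal} {A η m₁ m₂ : ℝ} (hm₁ : 0 < m₁) (hm : m₁ ≤ m₂)
    {B B' : Matrix (Fin d) (Fin d) ℝ} (hB : LoewnerBetween m₁ m₂ B)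
    (hB' : LoewnerBetween m₁ m₂ B') (x w : E d) :
    lyapunov F xs A η B' x w ≤ ENNReal.ofReal (m₂ / m₁) * lyapunov F xs A η B x w := by
  have h1 : 1 ≤ m₂ / m₁ := (one_le_div hm₁).2 hm
  have h2 : normSq B' (x - xs) ≤ m₂ / m₁ * normSq B (x - xs) := by
    calc normSq B' (x - xs) ≤ m₂ * ‖x - xs‖ ^ 2 := hB'.normSq_le _
      _ = m₂ / m₁ * (m₁ * ‖x - xs‖ ^ 2) := by field_simp
      _ ≤ _ := by gcongr; exact hB.le_normSq _
  have h3 : (1 : ℝ≥0∞) ≤ ENNReal.ofReal (m₂ / m₁) := by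
    rwa [← ENNReal.ofReal_one, ENNReal.ofReal_le_ofReal_iff (by positivity)]
  unfold lyapunov
  rw [mul_add, mul_add]
  gcongr ?_ + ?_ + ?_
  · rw [← ENNReal.ofReal_mul (by positivity)]
    exact ENNReal.ofReal_le_ofReal h2
  · exact le_mul_of_one_le_left zero_le h3
  · exact le_mul_of_one_le_left zero_le h3

/-- The contraction of the Lyapunov function, in the mean over the sampled index and the coin, by
one step in a fixed metric. -/
theorem mean_lyapunov_le [NeZero n] (hh : ProperConvexLSC h) (hf : HessianBounds f μ L)
    (hμ : 0 < μ) (hL : 0 < L) (hxs : ∀ z, objective f h xs ≤ objective f h z)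
    {p η m₁ m₂ A ρ : ℝ} (hp0 : 0 < p) (hp1 : p < 1) (hη : 0 < η) (hm₁ : 0 < m₁) (hm : m₁ ≤ m₂)
    (hA : 0 < A) (hηL : η ≤ m₁ / L)
    (hηA : η * (8 * m₂ * L / m₁ ^ 2 + 2 * μ / m₂ + A * p) ≤ 2)
    (hρ1 : 1 - η * μ / m₂ ≤ ρ) (hρ2 : 8 * m₂ * L / (m₁ ^ 2 * A) + 1 - p ≤ ρ)
    {B : Matrix (Fin d) (Fin d) ℝ} (hB : LoewnerBetween m₁ m₂ B) {x w : E d} {z : Fin n → E d}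
    (hmin : ∀ j u, subproblem h η B x (svrgGradient f j x w) (z j) ≤
      subproblem h η B x (svrgGradient f j x w) u) :
    ∑ j, (n : ℝ≥0∞)⁻¹ *
        (ENNReal.ofReal p * lyapunov (objective f h) xs A η B (z j) x +
          ENNReal.ofReal (1 - p) * lyapunov (objective f h) xs A η B (z j) w) ≤
      ENNReal.ofReal ρ * lyapunov (objective f h) xs A η B x w := by
  have hm₂ : 0 < m₂ := hm₁.trans_le hm
  have hn : (n : ℝ) ≠ 0 := Nat.cast_ne_zero.2 (NeZero.ne n)
  have hρ0 : 0 < ρ := by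
    have : 0 ≤ 8 * m₂ * L / (m₁ ^ 2 * A) := by positivity
    linarith
  by_cases hx : h x = ⊤
  · rw [lyapunov_eq_top hh hxs hA hη (Or.inl hx), ENNReal.mul_top (by simpa using hρ0)]
    exact le_top
  by_cases hw : h w = ⊤
  · rw [lyapunov_eq_top hh hxs hA hη (Or.inr hw), ENNReal.mul_top (by simpa using hρ0)]
    exact le_top
  obtain ⟨hs, es⟩ := hh.exists_eq_coe (hh.minimizer_ne_top hxs)
  obtain ⟨hx, ex⟩ := hh.exists_eq_coe hx
  obtain ⟨hw, ew⟩ := hh.exists_eq_coe hw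
  choose hz ez using fun j => hh.exists_eq_coe (hh.ne_top_of_isMin
    (q := fun u => inner ℝ (svrgGradient f j x w) (u - x) + 1 / (2 * η) * normSq B (u - x))
    (hmin j))
  have hN : ∀ y, 0 ≤ normSq B (y - xs) := fun y =>
    (by positivity : 0 ≤ m₁ * ‖y - xs‖ ^ 2).trans (hB.le_normSq _)
  have hdesc := mean_prox_descent hh hf hμ hL hxs hm₁ hm₂ hη hηL hB es ex ew ez hmin
  have gx := gap_nonneg hxs es ex
  have gw := gap_nonneg hxs es ew
  have gz := fun j => gap_nonneg hxs es (ez j)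
  rw [lyapunov_eq_ofReal hxs hA.le hη.le (hN x) es ex ew, ← ENNReal.ofReal_mul hρ0.le]
  set gx' := average f x + hx - (average f xs + hs)
  set gw' := average f w + hw - (average f xs + hs)
  have hsum : ∀ j, (n : ℝ≥0∞)⁻¹ *
        (ENNReal.ofReal p * lyapunov (objective f h) xs A η B (z j) x +
          ENNReal.ofReal (1 - p) * lyapunov (objective f h) xs A η B (z j) w) =
      ENNReal.ofReal ((n : ℝ)⁻¹ * ((normSq B (z j - xs) +
        2 * η * (average f (z j) + hz j - (average f xs + hs))) +
          A * η ^ 2 * (p * gx' + (1 - p) * gw'))) := fun j => by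
    have := hN (z j)
    have := gz j
    have hp' : 0 ≤ 1 - p := by linarith
    rw [lyapunov_eq_ofReal hxs hA.le hη.le (hN _) es (ez j) ex,
      lyapunov_eq_ofReal hxs hA.le hη.le (hN _) es (ez j) ew, ← ENNReal.ofReal_mul hp0.le,
      ← ENNReal.ofReal_mul hp', ← ENNReal.ofReal_add (by positivity) (by positivity),
      ← ENNReal.ofReal_natCast, ← ENNReal.ofReal_inv_of_pos (by positivity),
      ← ENNReal.ofReal_mul (by positivity)]
    congr 1
    ring
  rw [Finset.sum_congr rfl fun j _ => hsum j, ← ENNReal.ofReal_sum_of_nonneg fun j _ => by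
    have := hN (z j)
    have := gz j
    have hp' : 0 ≤ 1 - p := by linarith
    positivity]
  apply ENNReal.ofReal_le_ofReal
  rw [← Finset.mul_sum, Finset.sum_add_distrib, Finset.sum_const, Finset.card_univ,
    Fintype.card_fin, nsmul_eq_mul, mul_add, inv_mul_cancel_left₀ hn]
  -- it remains to compare the coefficients of `‖x - x*‖_B²`, `F(x) - F*` and `F(w) - F*`
  have hk : 8 * L / m₁ ≤ 8 * m₂ * L / m₁ ^ 2 := by
    rw [div_le_div_iff₀ hm₁ (by positivity)]
    have : 0 ≤ 8 * L * m₁ := by positivity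
    nlinarith
  have c1 : (1 - η * μ / m₂) * normSq B (x - xs) ≤ ρ * normSq B (x - xs) :=
    mul_le_mul_of_nonneg_right hρ1 (hN x)
  have c2 : 8 * L * η ^ 2 / m₁ + A * η ^ 2 * p ≤ ρ * (2 * η) := by
    have : 8 * L * η ^ 2 / m₁ + A * η ^ 2 * p = η * (η * (8 * L / m₁ + A * p)) := by ring
    rw [this]
    have h2 : η * (8 * L / m₁ + A * p) ≤ 2 * (1 - η * μ / m₂) := by
      have := mul_le_mul_of_nonneg_left hk hη.le
      have e : η * (8 * m₂ * L / m₁ ^ 2 + 2 * μ / m₂ + A * p) =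
        η * (8 * m₂ * L / m₁ ^ 2) + 2 * (η * μ / m₂) + η * (A * p) := by ring
      linarith
    nlinarith
  have c3 : 8 * L * η ^ 2 / m₁ + A * η ^ 2 * (1 - p) ≤ ρ * (A * η ^ 2) := by
    have e : 8 * m₂ * L / (m₁ ^ 2 * A) = 8 * m₂ * L / m₁ ^ 2 / A := by rw [div_div]
    rw [e] at hρ2
    have h2 : 8 * m₂ * L / m₁ ^ 2 / A * A = 8 * m₂ * L / m₁ ^ 2 := div_mul_cancel₀ _ hA.ne'
    have h3 := mul_le_mul_of_nonneg_right hρ2 hA.le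
    have h4 : 8 * L / m₁ + A * (1 - p) ≤ ρ * A := by
      have : (8 * m₂ * L / m₁ ^ 2 / A + 1 - p) * A =
        8 * m₂ * L / m₁ ^ 2 / A * A + A * (1 - p) := by ring
      linarith
    calc _ = (8 * L / m₁ + A * (1 - p)) * η ^ 2 := by ring
      _ ≤ ρ * A * η ^ 2 := by gcongr
      _ = _ := by ring
  have c2' := mul_le_mul_of_nonneg_right c2 gx
  have c3' := mul_le_mul_of_nonneg_right c3 gw
  linarith

end OneStep

/-! ### Dependence of the metric on the past -/

section Metric

variable {f : Fin n → E d → ℝ} {r l : ℕ}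

lemma xbar_congr {x x' : ℕ → E d} {t : ℕ} (hx : ∀ j ≤ t * r, x j = x' j) :
    xbar r x t = xbar r x' t := by
  cases t with
  | zero => rfl
  | succ t =>
    simp only [xbar]
    rw [Finset.sum_congr rfl fun j hj => hx j (Finset.mem_Ioc.1 hj).2]

lemma memory_congr {S S' : ℕ → Finset (Fin n)} {x x' : ℕ → E d} {t : ℕ}
    (hS : ∀ s, 1 ≤ s → s ≤ t → S s = S' s) (hx : ∀ j ≤ t * r, x j = x' j) :
    memory f r l S x t = memory f r l S' x' t := by
  induction t with
  | zero => rfl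
  | succ t ih =>
    have hle : t * r ≤ (t + 1) * r := Nat.mul_le_mul_right r t.le_succ
    have h1 := ih (fun s h1 h2 => hS s h1 (h2.trans t.le_succ)) fun j hj => hx j (hj.trans hle)
    have h2 : correctionPair f r S x (t + 1) = correctionPair f r S' x' (t + 1) := by
      simp only [correctionPair, Nat.add_sub_cancel, hS (t + 1) (by omega) le_rfl,
        xbar_congr hx, xbar_congr (t := t) fun j hj => hx j (hj.trans hle)]
    simp only [memory, h1, h2]

lemma metric_congr {S S' : ℕ → Finset (Fin n)} {x x' : ℕ → E d} {k : ℕ}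
    (hS : ∀ s, 1 ≤ s → s ≤ k → S s = S' s) (hx : ∀ j ≤ k, x j = x' j) :
    metric f r l S x k = metric f r l S' x' k := by
  unfold metric
  rw [memory_congr (fun s h1 h2 => hS s h1 (h2.trans (Nat.div_le_self k r)))
    fun j hj => hx j (hj.trans (Nat.div_mul_le_self k r))]

lemma metric_succ_of_not_dvd {S : ℕ → Finset (Fin n)} {x : ℕ → E d} {k : ℕ}
    (hk : ¬ r ∣ k + 1) : metric f r l S x (k + 1) = metric f r l S x k := by
  have h1 : (k + 1) / r = k / r := Nat.succ_div_of_not_dvd hk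
  have h2 : k + 1 < r ↔ k < r := by
    refine ⟨fun h => by omega, fun h => ?_⟩
    rcases (Nat.succ_le_of_lt h).eq_or_lt with h' | h'
    · exact absurd ⟨1, by simpa using h'⟩ hk
    · exact h'
  simp only [metric, h1, h2]

end Metric

/-! ### The iterates as functions of the sampling history -/

/-- The proximal point: a minimizer of the subproblem, arbitrary if there is none. -/
noncomputable def proxPoint (h : E d → EReal) (η : ℝ) (B : Matrix (Fin d) (Fin d) ℝ) (x v : E d) : E d :=
  Classical.epsilon fun z => ∀ u, subproblem h η B x v z ≤ subproblem h η B x v u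

/-- The random choices of the first `k` steps. The `j`-th entry holds the index and the coin of
step `j` and the batch `S^{j+1}`; as `S^t` is not used before step `t r ≥ t`, the first `k` entries
determine `x_0, …, x_k`, `w_k` and the metric `B_k`. -/
def history {Ω : Type*} (i : ℕ → Ω → Fin n) (c : ℕ → Ω → Bool) (S : ℕ → Ω → Finset (Fin n))
    (k : ℕ) (ω : Ω) : Fin k → Fin n × Bool × Finset (Fin n) :=
  fun j => (i j ω, c j ω, S (j + 1) ω)

/-- The batches recorded in a history; `∅` for those not yet sampled. -/
def batches {k : ℕ} (g : Fin k → Fin n × Bool × Finset (Fin n)) (t : ℕ) : Finset (Fin n) :=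
  if ht : t - 1 < k then (g ⟨t - 1, ht⟩).2.2 else ∅

lemma batches_history {Ω : Type*} (i : ℕ → Ω → Fin n) (c : ℕ → Ω → Bool)
    (S : ℕ → Ω → Finset (Fin n)) {k t : ℕ} (h1 : 1 ≤ t) (hk : t ≤ k) (ω : Ω) :
    batches (history i c S k ω) t = S t ω := by
  have : t - 1 < k := by omega
  simp [batches, history, this, Nat.sub_add_cancel h1]

lemma history_preimage {Ω : Type*} (i : ℕ → Ω → Fin n) (c : ℕ → Ω → Bool)
    (S : ℕ → Ω → Finset (Fin n)) (k : ℕ) (g : Fin k → Fin n × Bool × Finset (Fin n)) :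
    history i c S k ⁻¹' {g} = ⋂ j : Fin k, (i j ⁻¹' {(g j).1} ∩ (c j ⁻¹' {(g j).2.1} ∩
      S (j + 1) ⁻¹' {(g j).2.2})) := by
  ext ω
  simp [history, funext_iff, Prod.ext_iff]

section Run

variable {f : Fin n → E d → ℝ} {h : E d → EReal}

lemma IsRun.succ_eq_proxPoint (hh : ProperConvexLSC h) {η : ℝ} (hη : 0 < η) {r l : ℕ}
    {x0 : E d} {i : ℕ → Fin n} {c : ℕ → Bool} {S : ℕ → Finset (Fin n)} {x w : ℕ → E d}
    (hrun : IsRun f h η r l x0 i c S x w) {m₁ m₂ : ℝ} (hm₁ : 0 < m₁) {k : ℕ}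
    (hB : LoewnerBetween m₁ m₂ (metric f r l S x k)) :
    x (k + 1) = proxPoint h η (metric f r l S x k) (x k)
      (svrgGradient f (i k) (x k) (w k)) :=
  hh.prox_unique hη hm₁ hB (hrun.x_succ k)
    (Classical.epsilon_spec (p := fun z => ∀ u, subproblem h η (metric f r l S x k) (x k)
      (svrgGradient f (i k) (x k) (w k)) z ≤ subproblem h η (metric f r l S x k) (x k)
      (svrgGradient f (i k) (x k) (w k)) u) ⟨_, hrun.x_succ k⟩)

/-- Almost surely, the state after `k` steps is a function of the history. As the history takes
finitely many values, this makes all quantities of the algorithm measurable, without any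
measurability of the proximal map. -/
lemma exists_eq_history {Ω : Type*} [MeasurableSpace Ω] {P : Measure Ω}
    (hh : ProperConvexLSC h) {η : ℝ} (hη : 0 < η) {r l : ℕ} {x0 : E d}
    {i : ℕ → Ω → Fin n} {c : ℕ → Ω → Bool} {S : ℕ → Ω → Finset (Fin n)} {x w : ℕ → Ω → E d}
    (hrun : ∀ᵐ ω ∂P, IsRun f h η r l x0
      (fun k => i k ω) (fun k => c k ω) (fun t => S t ω) (fun k => x k ω) (fun k => w k ω))
    {m₁ m₂ : ℝ} (hm₁ : 0 < m₁)
    (hB : ∀ᵐ ω ∂P, ∀ k,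
      LoewnerBetween m₁ m₂ (metric f r l (fun t => S t ω) (fun j => x j ω) k)) (k : ℕ) :
    ∃ (X : (Fin k → Fin n × Bool × Finset (Fin n)) → ℕ → E d)
      (W : (Fin k → Fin n × Bool × Finset (Fin n)) → E d),
      ∀ᵐ ω ∂P, (∀ j ≤ k, x j ω = X (history i c S k ω) j) ∧ w k ω = W (history i c S k ω) := by
  induction k with
  | zero =>
    refine ⟨fun _ _ => x0, fun _ => x0, ?_⟩
    filter_upwards [hrun] with ω hω
    refine ⟨fun j hj => ?_, hω.w_zero⟩
    rw [Nat.le_zero.1 hj]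
    exact hω.x_zero
  | succ k ih =>
    obtain ⟨X, W, hXW⟩ := ih
    refine ⟨fun g => Function.update (X (Fin.init g)) (k + 1) (proxPoint h η
        (metric f r l (batches (Fin.init g)) (X (Fin.init g)) k) (X (Fin.init g) k)
        (svrgGradient f (g (Fin.last k)).1 (X (Fin.init g) k) (W (Fin.init g)))),
      fun g => if (g (Fin.last k)).2.1 = true then X (Fin.init g) k else W (Fin.init g), ?_⟩
    filter_upwards [hrun, hB, hXW] with ω hω hBω hk
    have hinit : Fin.init (history i c S (k + 1) ω) = history i c S k ω := rfl
    have hi : (history i c S (k + 1) ω (Fin.last k)).1 = i k ω := rfl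
    have hc : (history i c S (k + 1) ω (Fin.last k)).2.1 = c k ω := rfl
    have hm : metric f r l (batches (history i c S k ω)) (X (history i c S k ω)) k =
        metric f r l (fun t => S t ω) (fun j => x j ω) k :=
      metric_congr (fun s h1 h2 => batches_history i c S h1 h2 ω) fun j hj => (hk.1 j hj).symm
    simp only [hinit, hi, hc, hm, ← hk.1 k le_rfl, ← hk.2]
    refine ⟨fun j hj => ?_, hω.w_succ k⟩
    rcases hj.eq_or_lt with rfl | hj
    · rw [Function.update_self]
      exact hω.succ_eq_proxPoint hh hη hm₁ (hBω k)
    · rw [Function.update_of_ne hj.ne]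
      exact hk.1 j (Nat.lt_succ_iff.1 hj)

end Run

/-! ### Independence of the sampling from the history -/

section Sampling

variable {Ω : Type*} [MeasurableSpace Ω] {P : Measure Ω}

lemma measurable_comp_of_finite {α β : Type*} [Finite α] [MeasurableSpace β] {Z : Ω → α}
    (hZ : ∀ a, MeasurableSet (Z ⁻¹' {a})) (φ : α → β) : Measurable fun ω => φ (Z ω) := by
  let _ : MeasurableSpace α := ⊤
  exact (measurable_from_top (f := φ)).comp (measurable_to_countable' hZ)

lemma lintegral_comp_of_fintype {α : Type*} [Fintype α] {Z : Ω → α}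
    (hZ : ∀ a, MeasurableSet (Z ⁻¹' {a})) (φ : α → ℝ≥0∞) :
    ∫⁻ ω, φ (Z ω) ∂P = ∑ a, φ a * P (Z ⁻¹' {a}) := by
  let _ : MeasurableSpace α := ⊤
  have hm : Measurable Z := measurable_to_countable' hZ
  rw [← lintegral_map (measurable_from_top (f := φ)) hm, lintegral_fintype]
  exact Finset.sum_congr rfl fun a _ => by rw [Measure.map_apply hm trivial]

variable {p : ℝ} {i : ℕ → Ω → Fin n} {c : ℕ → Ω → Bool} {S : ℕ → Ω → Finset (Fin n)}

lemma IsSampling.measurableSet_history (hs : IsSampling P p i c S) (k : ℕ)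
    (g : Fin k → Fin n × Bool × Finset (Fin n)) :
    MeasurableSet (history i c S k ⁻¹' {g}) := by
  rw [history_preimage]
  exact MeasurableSet.iInter fun j => (hs.measurable_index _ _).inter
    ((hs.measurable_coin _ _).inter (hs.measurable_batch _ _))

lemma IsSampling.measure_history_inter (hs : IsSampling P p i c S) (k : ℕ)
    (g : Fin k → Fin n × Bool × Finset (Fin n)) (j : Fin n) (b : Bool) :
    P (history i c S k ⁻¹' {g} ∩ (i k ⁻¹' {j} ∩ c k ⁻¹' {b})) =
      P (history i c S k ⁻¹' {g}) * (P (i k ⁻¹' {j}) * P (c k ⁻¹' {b})) := by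
  set m : ℕ ⊕ (ℕ ⊕ ℕ) → MeasurableSpace Ω :=
    Sum.elim (fun k : ℕ => MeasurableSpace.comap (i k) ⊤)
      (Sum.elim (fun k : ℕ => MeasurableSpace.comap (c k) ⊤)
        (fun t : ℕ => MeasurableSpace.comap (S t) ⊤)) with hm
  have hle : ∀ a, m a ≤ ‹MeasurableSpace Ω› := by
    have hcomap : ∀ {α : Type} [Finite α] (Z : Ω → α), (∀ a, MeasurableSet (Z ⁻¹' {a})) →
        MeasurableSpace.comap Z ⊤ ≤ ‹MeasurableSpace Ω› := by
      intro α _ Z hZ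
      let _ : MeasurableSpace α := ⊤
      exact (measurable_to_countable' hZ).comap_le
    rintro (a | a | a)
    · exact hcomap _ (hs.measurable_index a)
    · exact hcomap _ (hs.measurable_coin a)
    · exact hcomap _ (hs.measurable_batch a)
  have hi : ∀ k j, MeasurableSet[m (Sum.inl k)] (i k ⁻¹' {j}) := fun k j => ⟨{j}, trivial, rfl⟩
  have hc : ∀ k b, MeasurableSet[m (Sum.inr (Sum.inl k))] (c k ⁻¹' {b}) :=
    fun k b => ⟨{b}, trivial, rfl⟩
  have hS : ∀ k T, MeasurableSet[m (Sum.inr (Sum.inr k))] (S k ⁻¹' {T}) :=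
    fun k T => ⟨{T}, trivial, rfl⟩
  set I : Set (ℕ ⊕ (ℕ ⊕ ℕ)) := {Sum.inl k, Sum.inr (Sum.inl k)} with hI
  have hind := (Indep_iff _ _ _).1 (indep_iSup_of_disjoint hle hs.indep
    (disjoint_compl_left (a := I)))
  have hind' := (Indep_iff _ _ _).1 (hs.indep.indep
    (show (Sum.inl k : ℕ ⊕ (ℕ ⊕ ℕ)) ≠ Sum.inr (Sum.inl k) by simp))
  rw [hind _ _ ?_ ?_, hind' _ _ (hi k j) (hc k b)]
  · have hmem : ∀ a ∈ Iᶜ, m a ≤ ⨆ a ∈ Iᶜ, m a := fun a ha => le_iSup₂_of_le a ha le_rfl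
    rw [history_preimage]
    refine MeasurableSet.iInter fun a => ?_
    have ha := a.2.ne
    exact ((hmem _ (by simp [hI, ha])) _ (hi _ _)).inter
      (((hmem _ (by simp [hI, ha])) _ (hc _ _)).inter ((hmem _ (by simp [hI])) _ (hS _ _)))
  · have hmem : ∀ a ∈ I, m a ≤ ⨆ a ∈ I, m a := fun a ha => le_iSup₂_of_le a ha le_rfl
    exact ((hmem _ (by simp [hI])) _ (hi _ _)).inter ((hmem _ (by simp [hI])) _ (hc _ _))

lemma IsSampling.coin_false [IsProbabilityMeasure P] (hs : IsSampling P p i c S) (hp : 0 ≤ p)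
    (k : ℕ) : P (c k ⁻¹' {false}) = ENNReal.ofReal (1 - p) := by
  have : c k ⁻¹' {false} = {ω | c k ω = true}ᶜ := by ext ω; simp
  rw [this, prob_compl_eq_one_sub (hs.measurable_coin k true), hs.coin_law,
    ENNReal.ofReal_sub _ hp, ENNReal.ofReal_one]

/-- Integrating out the index and the coin of step `k`. -/
lemma IsSampling.lintegral_step [IsProbabilityMeasure P] (hs : IsSampling P p i c S)
    (hp : 0 ≤ p) (k : ℕ)
    (Θ : (Fin k → Fin n × Bool × Finset (Fin n)) → Fin n → Bool → ℝ≥0∞) :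
    ∫⁻ ω, Θ (history i c S k ω) (i k ω) (c k ω) ∂P =
      ∫⁻ ω, ∑ j, (n : ℝ≥0∞)⁻¹ * (ENNReal.ofReal p * Θ (history i c S k ω) j true +
        ENNReal.ofReal (1 - p) * Θ (history i c S k ω) j false) ∂P := by
  have hpre : ∀ a : (Fin k → Fin n × Bool × Finset (Fin n)) × Fin n × Bool,
      (fun ω => (history i c S k ω, i k ω, c k ω)) ⁻¹' {a} =
        history i c S k ⁻¹' {a.1} ∩ (i k ⁻¹' {a.2.1} ∩ c k ⁻¹' {a.2.2}) := fun a => by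
    ext ω; simp [Prod.ext_iff]
  rw [lintegral_comp_of_fintype (Z := fun ω => (history i c S k ω, i k ω, c k ω))
    (φ := fun a => Θ a.1 a.2.1 a.2.2) fun a => by
      rw [hpre]
      exact (hs.measurableSet_history k _).inter
        ((hs.measurable_index _ _).inter (hs.measurable_coin _ _)),
    lintegral_comp_of_fintype (Z := history i c S k) (hs.measurableSet_history k)
      (φ := fun g => ∑ j, (n : ℝ≥0∞)⁻¹ * (ENNReal.ofReal p * Θ g j true +
        ENNReal.ofReal (1 - p) * Θ g j false)), Fintype.sum_prod_type]
  refine Finset.sum_congr rfl fun g _ => ?_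
  rw [Fintype.sum_prod_type, Finset.sum_mul]
  refine Finset.sum_congr rfl fun j _ => ?_
  have h1 : P (i k ⁻¹' {j}) = (n : ℝ≥0∞)⁻¹ := hs.index_law k j
  have h2 : P (c k ⁻¹' {true}) = ENNReal.ofReal p := hs.coin_law k
  simp only [Fintype.sum_bool, hpre, hs.measure_history_inter, h1, h2, hs.coin_false hp]
  ring

end Sampling

/-! ### The linear rate -/

lemma lyapunov_of_subsingleton {f : Fin n → E d → ℝ} {h : E d → EReal} [Subsingleton (E d)]
    (hh : ProperConvexLSC h) {xs : E d} (hxs : ∀ z, objective f h xs ≤ objective f h z) (A η : ℝ)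
    (B : Matrix (Fin d) (Fin d) ℝ) (x w : E d) : lyapunov (objective f h) xs A η B x w = 0 := by
  obtain ⟨hs, es⟩ := hh.exists_eq_coe (hh.minimizer_ne_top hxs)
  have hF : objective f h xs - objective f h xs = 0 := by
    unfold objective
    rw [es, ← EReal.coe_add, ← EReal.coe_sub, sub_self, EReal.coe_zero]
  simp [Subsingleton.elim x xs, Subsingleton.elim w xs, lyapunov, hF, normSq]

lemma LoewnerBetween.le_of_pos {a b : ℝ} {B : Matrix (Fin d) (Fin d) ℝ}
    (hB : LoewnerBetween a b B) (hd : 0 < d) : a ≤ b := by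
  have h := (hB.le_normSq (EuclideanSpace.single ⟨0, hd⟩ 1)).trans (hB.normSq_le _)
  simpa using h

/-- The `k / r` changes of metric up to step `k` cost at most the factor of the stated rate. -/
lemma pow_div_mul_pow_le {q ρ : ℝ} (hq : 1 ≤ q) (hρ : 0 < ρ) {r : ℕ} (hr : 0 < r)
    (hrate : q ^ (1 / (r : ℝ)) * ρ < 1) (k : ℕ) :
    q ^ (k / r) * ρ ^ k ≤ (q ^ (1 / (r : ℝ)) * ρ) ^ k * (q * ρ ^ r)⁻¹ := by
  set s := q ^ (1 / (r : ℝ)) with hs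
  have hs1 : 1 ≤ s := Real.one_le_rpow hq (by positivity)
  have hsr : s ^ r = q := by
    rw [hs, one_div, Real.rpow_inv_natCast_pow (by linarith) hr.ne']
  have h1 : 1 ≤ (q * ρ ^ r)⁻¹ := by
    rw [← hsr, ← mul_pow]
    exact (one_le_inv₀ (by positivity)).2 (pow_le_one₀ (by positivity) hrate.le)
  calc q ^ (k / r) * ρ ^ k = s ^ (r * (k / r)) * ρ ^ k := by rw [pow_mul, hsr]
    _ ≤ s ^ k * ρ ^ k := by
      gcongr
      exact Nat.mul_div_le k r
    _ = (s * ρ) ^ k * 1 := by rw [mul_pow, mul_one]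
    _ ≤ _ := by gcongr

section Rate

variable {Ω : Type*} [MeasurableSpace Ω] {P : Measure Ω}
  {f : Fin n → E d → ℝ} {h : E d → EReal} {μ L : ℝ} {xs : E d} {p : ℝ}
  {i : ℕ → Ω → Fin n} {c : ℕ → Ω → Bool} {S : ℕ → Ω → Finset (Fin n)}
  {η : ℝ} {r l : ℕ} {x0 : E d} {x w : ℕ → Ω → E d} {m₁ m₂ A ρ : ℝ}

lemma aemeasurable_lyapunov (hh : ProperConvexLSC h) (hsamp : IsSampling P p i c S)
    (hη : 0 < η)
    (hrun : ∀ᵐ ω ∂P, IsRun f h η r l x0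
      (fun k => i k ω) (fun k => c k ω) (fun t => S t ω) (fun k => x k ω) (fun k => w k ω))
    (hm₁ : 0 < m₁)
    (hB : ∀ᵐ ω ∂P, ∀ k,
      LoewnerBetween m₁ m₂ (metric f r l (fun t => S t ω) (fun j => x j ω) k)) (k : ℕ) :
    AEMeasurable (fun ω => lyapunov (objective f h) xs A η
      (metric f r l (fun t => S t ω) (fun j => x j ω) k) (x k ω) (w k ω)) P := by
  obtain ⟨X, W, hXW⟩ := exists_eq_history hh hη hrun hm₁ hB k
  refine ⟨_, measurable_comp_of_finite (hsamp.measurableSet_history k)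
    (fun g => lyapunov (objective f h) xs A η (metric f r l (batches g) (X g) k) (X g k) (W g)), ?_⟩
  filter_upwards [hXW] with ω hω
  rw [← hω.1 k le_rfl, ← hω.2, metric_congr
    (fun s h1 h2 => batches_history i c S h1 h2 ω) fun j hj => (hω.1 j hj).symm]

/-- The contraction in expectation by one step, with the Lyapunov function of the new state measured
in the old metric. -/
lemma lintegral_lyapunov_succ_le [NeZero n] [IsProbabilityMeasure P]
    (hh : ProperConvexLSC h) (hf : HessianBounds f μ L)
    (hμ : 0 < μ) (hL : 0 < L) (hxs : ∀ z, objective f h xs ≤ objective f h z)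
    (hp0 : 0 < p) (hp1 : p < 1) (hsamp : IsSampling P p i c S) (hη : 0 < η)
    (hrun : ∀ᵐ ω ∂P, IsRun f h η r l x0
      (fun k => i k ω) (fun k => c k ω) (fun t => S t ω) (fun k => x k ω) (fun k => w k ω))
    (hm₁ : 0 < m₁) (hm : m₁ ≤ m₂)
    (hB : ∀ᵐ ω ∂P, ∀ k,
      LoewnerBetween m₁ m₂ (metric f r l (fun t => S t ω) (fun j => x j ω) k))
    (hA : 0 < A) (hηL : η ≤ m₁ / L)
    (hηA : η * (8 * m₂ * L / m₁ ^ 2 + 2 * μ / m₂ + A * p) ≤ 2)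
    (hρ1 : 1 - η * μ / m₂ ≤ ρ) (hρ2 : 8 * m₂ * L / (m₁ ^ 2 * A) + 1 - p ≤ ρ) (k : ℕ) :
    ∫⁻ ω, lyapunov (objective f h) xs A η (metric f r l (fun t => S t ω) (fun j => x j ω) k)
        (x (k + 1) ω) (w (k + 1) ω) ∂P ≤
      ENNReal.ofReal ρ * ∫⁻ ω, lyapunov (objective f h) xs A η
        (metric f r l (fun t => S t ω) (fun j => x j ω) k) (x k ω) (w k ω) ∂P := by
  obtain ⟨X, W, hXW⟩ := exists_eq_history hh hη hrun hm₁ hB k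
  have hmetric : ∀ ω, (∀ j ≤ k, x j ω = X (history i c S k ω) j) →
      metric f r l (batches (history i c S k ω)) (X (history i c S k ω)) k =
        metric f r l (fun t => S t ω) (fun j => x j ω) k := fun ω hω =>
    metric_congr (fun s h1 h2 => batches_history i c S h1 h2 ω) fun j hj => (hω j hj).symm
  -- the value after step `k`, in terms of the history, the sampled index and the coin
  let Θ : (Fin k → Fin n × Bool × Finset (Fin n)) → Fin n → Bool → ℝ≥0∞ := fun g j b =>
    lyapunov (objective f h) xs A η (metric f r l (batches g) (X g) k)
      (proxPoint h η (metric f r l (batches g) (X g) k) (X g k)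
        (svrgGradient f j (X g k) (W g))) (if b = true then X g k else W g)
  have hΘ : ∀ᵐ ω ∂P, lyapunov (objective f h) xs A η
      (metric f r l (fun t => S t ω) (fun j => x j ω) k) (x (k + 1) ω) (w (k + 1) ω) =
      Θ (history i c S k ω) (i k ω) (c k ω) := by
    filter_upwards [hXW, hrun, hB] with ω hω hr hBω
    simp only [Θ, hmetric ω hω.1, ← hω.1 k le_rfl, ← hω.2]
    rw [hr.succ_eq_proxPoint hh hη hm₁ (hBω k), hr.w_succ k]
  rw [lintegral_congr_ae hΘ, hsamp.lintegral_step hp0.le,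
    ← lintegral_const_mul' _ _ ENNReal.ofReal_ne_top]
  refine lintegral_mono_ae ?_
  filter_upwards [hXW, hB] with ω hω hBω
  simp only [Θ, hmetric ω hω.1, ← hω.1 k le_rfl, ← hω.2, if_true, Bool.false_eq_true, if_false]
  refine mean_lyapunov_le hh hf hμ hL hxs hp0 hp1 hη hm₁ hm hA hηL hηA hρ1 hρ2 (hBω k) fun j => ?_
  obtain ⟨hs, es⟩ := hh.exists_eq_coe (hh.minimizer_ne_top hxs)
  exact Classical.epsilon_spec (p := fun z => ∀ u, subproblem h η _ (x k ω)
      (svrgGradient f j (x k ω) (w k ω)) z ≤ subproblem h η _ (x k ω)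
      (svrgGradient f j (x k ω) (w k ω)) u)
    (hh.exists_prox es (affine_minorant hh hf hxs es) hη hm₁ (hBω k) (x k ω) _)

lemma lintegral_lyapunov_le [NeZero n] [IsProbabilityMeasure P]
    (hh : ProperConvexLSC h) (hf : HessianBounds f μ L)
    (hμ : 0 < μ) (hL : 0 < L) (hxs : ∀ z, objective f h xs ≤ objective f h z)
    (hp0 : 0 < p) (hp1 : p < 1) (hsamp : IsSampling P p i c S) (hη : 0 < η) (hr : 0 < r)
    (hrun : ∀ᵐ ω ∂P, IsRun f h η r l x0
      (fun k => i k ω) (fun k => c k ω) (fun t => S t ω) (fun k => x k ω) (fun k => w k ω))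
    (hm₁ : 0 < m₁) (hm : m₁ ≤ m₂)
    (hB : ∀ᵐ ω ∂P, ∀ k,
      LoewnerBetween m₁ m₂ (metric f r l (fun t => S t ω) (fun j => x j ω) k))
    (hA : 0 < A) (hηL : η ≤ m₁ / L)
    (hηA : η * (8 * m₂ * L / m₁ ^ 2 + 2 * μ / m₂ + A * p) ≤ 2) (hρ : 0 < ρ)
    (hρ1 : 1 - η * μ / m₂ ≤ ρ) (hρ2 : 8 * m₂ * L / (m₁ ^ 2 * A) + 1 - p ≤ ρ) (k : ℕ) :
    ∫⁻ ω, lyapunov (objective f h) xs A η (metric f r l (fun t => S t ω) (fun j => x j ω) k)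
        (x k ω) (w k ω) ∂P ≤
      ENNReal.ofReal ((m₂ / m₁) ^ (k / r) * ρ ^ k) *
        lyapunov (objective f h) xs A η 1 x0 x0 := by
  have hq : 0 < m₂ / m₁ := div_pos (hm₁.trans_le hm) hm₁
  induction k with
  | zero =>
    have h0 : ∀ᵐ ω ∂P, lyapunov (objective f h) xs A η
        (metric f r l (fun t => S t ω) (fun j => x j ω) 0) (x 0 ω) (w 0 ω) =
        lyapunov (objective f h) xs A η 1 x0 x0 := by
      filter_upwards [hrun] with ω hω
      rw [hω.x_zero, hω.w_zero, metric, if_pos hr]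
    rw [lintegral_congr_ae h0]
    simp
  | succ k ih =>
    -- the metric changes only if `r ∣ k + 1`
    set C : ℝ := if r ∣ k + 1 then m₂ / m₁ else 1 with hC
    have hC0 : 0 ≤ C := by rw [hC]; split_ifs <;> positivity
    have hstep : ∀ᵐ ω ∂P, lyapunov (objective f h) xs A η
        (metric f r l (fun t => S t ω) (fun j => x j ω) (k + 1)) (x (k + 1) ω) (w (k + 1) ω) ≤
        ENNReal.ofReal C * lyapunov (objective f h) xs A η
        (metric f r l (fun t => S t ω) (fun j => x j ω) k) (x (k + 1) ω) (w (k + 1) ω) := by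
      filter_upwards [hB] with ω hω
      by_cases hdvd : r ∣ k + 1
      · rw [hC, if_pos hdvd]
        exact lyapunov_le_mul_of_loewner hm₁ hm (hω k) (hω (k + 1)) _ _
      · rw [hC, if_neg hdvd, metric_succ_of_not_dvd hdvd, ENNReal.ofReal_one, one_mul]
    have hpow : (m₂ / m₁) ^ ((k + 1) / r) * ρ ^ (k + 1) =
        C * (ρ * ((m₂ / m₁) ^ (k / r) * ρ ^ k)) := by
      rw [Nat.succ_div, hC]
      split_ifs <;> ring
    refine (lintegral_mono_ae hstep).trans ?_
    rw [lintegral_const_mul' _ _ ENNReal.ofReal_ne_top, hpow, ENNReal.ofReal_mul hC0,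
      ENNReal.ofReal_mul hρ.le, mul_assoc, mul_assoc]
    gcongr
    refine (lintegral_lyapunov_succ_le hh hf hμ hL hxs hp0 hp1 hsamp hη hrun hm₁ hm hB hA hηL hηA
      hρ1 hρ2 k).trans ?_
    gcongr

end Rate

end SPQN

theorem mainTheorem1 {d n : ℕ} {Ω : Type*} [MeasurableSpace Ω] (P : MeasureTheory.Measure Ω)
    [MeasureTheory.IsProbabilityMeasure P]
    (f : Fin n → SPQN.E d → ℝ) (h : SPQN.E d → EReal) (hh : SPQN.ProperConvexLSC h)
    (μ L : ℝ) (hμ : 0 < μ) (hL : 0 < L) (hf : SPQN.HessianBounds f μ L)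
    -- the minimizer of `F = f + h`
    (xs : SPQN.E d) (hxs : ∀ z, SPQN.objective f h xs ≤ SPQN.objective f h z)
    -- the randomness
    (p : ℝ) (hp0 : 0 < p) (hp1 : p < 1)
    (i : ℕ → Ω → Fin n) (c : ℕ → Ω → Bool) (S : ℕ → Ω → Finset (Fin n))
    (hsamp : SPQN.IsSampling P p i c S)
    -- the iterates
    (η : ℝ) (hη : 0 < η) (r l : ℕ) (hr : 0 < r) (x0 : SPQN.E d) (x w : ℕ → Ω → SPQN.E d)
    (hrun : ∀ᵐ ω ∂P, SPQN.IsRun f h η r l x0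
      (fun k => i k ω) (fun k => c k ω) (fun t => S t ω) (fun k => x k ω) (fun k => w k ω))
    -- the constants
    (m₁ m₂ : ℝ) (hm₁ : 0 < m₁) (hm₂ : 0 < m₂)
    (hB : ∀ᵐ ω ∂P, ∀ k,
      SPQN.LoewnerBetween m₁ m₂ (SPQN.metric f r l (fun t => S t ω) (fun j => x j ω) k))
    (A : ℝ) (hA : 8 * m₂ * L / (m₁ ^ 2 * p) < A)
    (hηle : η ≤ min (m₁ / L)
      (2 * m₁ ^ 2 * m₂ / (8 * m₂ ^ 2 * L + 2 * m₁ ^ 2 * μ + A * p * m₁ ^ 2 * m₂)))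
    (ρ : ℝ) (hρ : ρ = max (1 - η * μ / m₂) (8 * m₂ * L / (m₁ ^ 2 * A) + 1 - p))
    (hrρ : (m₂ / m₁) ^ (1 / (r : ℝ)) * ρ < 1) :
    (0 < ρ ∧ ρ < 1) ∧
    ∀ k, r ≤ k →
      AEMeasurable (fun ω => SPQN.lyapunov (SPQN.objective f h) xs A η
        (SPQN.metric f r l (fun t => S t ω) (fun j => x j ω) k) (x k ω) (w k ω)) P ∧
      ∫⁻ ω, SPQN.lyapunov (SPQN.objective f h) xs A η
          (SPQN.metric f r l (fun t => S t ω) (fun j => x j ω) k) (x k ω) (w k ω) ∂P ≤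
        ENNReal.ofReal
            (((m₂ / m₁) ^ (1 / (r : ℝ)) * ρ) ^ k * ((m₂ / m₁) * ρ ^ r)⁻¹) *
          SPQN.lyapunov (SPQN.objective f h) xs A η 1 x0 x0 := by
  have hA0 : 0 < A := lt_of_le_of_lt (by positivity) hA
  have hη1 := hηle.trans (min_le_left _ _)
  have hη2 := hηle.trans (min_le_right _ _)
  have hρ1 : 1 - η * μ / m₂ ≤ ρ := hρ ▸ le_max_left _ _
  have hρ2 : 8 * m₂ * L / (m₁ ^ 2 * A) + 1 - p ≤ ρ := hρ ▸ le_max_right _ _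
  have hρ0 : 0 < ρ := by
    have : 0 ≤ 8 * m₂ * L / (m₁ ^ 2 * A) := by positivity
    linarith
  have hρlt : ρ < 1 := by
    rw [hρ, max_lt_iff]
    constructor
    · have : 0 < η * μ / m₂ := by positivity
      linarith
    · have : 8 * m₂ * L / (m₁ ^ 2 * A) < p := by
        rw [div_lt_iff₀ (by positivity)] at hA ⊢
        linarith
      linarith
  refine ⟨⟨hρ0, hρlt⟩, fun k _ =>
    ⟨SPQN.aemeasurable_lyapunov hh hsamp hη hrun hm₁ hB k, ?_⟩⟩
  -- in dimension zero `m₁ ≤ m₂` may fail, but then `φ_k = 0`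
  rcases Nat.eq_zero_or_pos d with rfl | hd
  · simp [SPQN.lyapunov_of_subsingleton hh hxs]
  obtain ⟨ω, hω⟩ := hB.exists
  have hm : m₁ ≤ m₂ := (hω 0).le_of_pos hd
  have : NeZero n := ⟨fun hn => (hn ▸ i 0 ω).elim0⟩
  have hηA : η * (8 * m₂ * L / m₁ ^ 2 + 2 * μ / m₂ + A * p) ≤ 2 := by
    rw [le_div_iff₀ (by positivity)] at hη2
    have e : η * (8 * m₂ * L / m₁ ^ 2 + 2 * μ / m₂ + A * p) =
        η * (8 * m₂ ^ 2 * L + 2 * m₁ ^ 2 * μ + A * p * m₁ ^ 2 * m₂) / (m₁ ^ 2 * m₂) := by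
      field_simp
    rw [e, div_le_iff₀ (by positivity)]
    linarith
  refine (SPQN.lintegral_lyapunov_le hh hf hμ hL hxs hp0 hp1 hsamp hη hr hrun hm₁ hm hB hA0 hη1 hηA
    hρ0 hρ1 hρ2 k).trans ?_
  refine mul_le_mul_left (ENNReal.ofReal_le_ofReal ?_) _
  exact SPQN.pow_div_mul_pow_le ((one_le_div hm₁).2 hm) hρ0 hr hrρ k
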